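/- **Setting.** Let $\ell,\ell_f,N$ be integers with $N\ge 1$, $\ell_f\ge 0$, and $\ell' := \ell_f+2\le \ell$. Additive sharing of $x\in\mathbb Z_{2^\ell}$ means $\langle x\rangle=(\langle x\rangle_0,\langle x\rangle_1)=(x-\rho,\rho)$ with $\rho\in\mathbb Z_{2^\ell}$ uniform; $\langle x\rangle_b$ is held by party $P_b$. For $0\le i<N$ the parties hold arbitrary shares $\langle s_i\rangle_b,\langle g_i\rangle_b\in\mathbb Z_{2^\ell}$ with $s_i=\langle s_i\rangle_0+\langle s_i\rangle_1\in\{0,1\}$ and $g_i=\langle g_i\rangle_0+\langle g_i\rangle_1\equiv$ an integer in $[-2^{\ell_f},2^{\ell_f}-1]$ modulo $2^\ell$. Residues are identified with their representatives in $[0,2^n)$ whenever they are moved between moduli. **Protocol $\Pi_{\mathrm{Agg}}$.** *Offline:* for each $i$ independently, a trusted dealer, who receives nothing from the parties, draws $r_{s_i}\in\mathbb Z_2$ and $r_{g_i}\in\mathbb Z_{2^{\ell'}}$ uniformly, puts $u_i=r_{s_i}r_{g_i}$, $v_i=r_{g_i}\gg(\ell'-1)$, $m_i=r_{s_i}v_i$,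 shares $r_{s_i},r_{g_i},u_i,v_i,m_i$ additively over $\mathbb Z_{2^\ell}$ with fresh independent randomness, and sends $P_b$ its five shares, the key $\mathcal K_{b,i}$. *Online:* for each $i$, $P_b$ sends to $P_{1-b}$ the bit $(\langle s_i\rangle_b \bmod 2)+\langle r_{s_i}\rangle_b \bmod 2$ and the $\ell'$-bit word $\langle g_i\rangle_b+\langle r_{g_i}\rangle_b \bmod 2^{\ell'}$. From their own and the received messages both parties obtain the opened values: $\hat s_i\in\mathbb Z_2$, the sum of the two bits (so $\hat s_i=s_i\oplus r_{s_i}$), and $\hat g'_i\in\mathbb Z_{2^{\ell'}}$, the sum of the two words plus $2^{\ell_f}$ (so $\hat g'_i=g_i+2^{\ell_f}+r_{g_i}\bmod 2^{\ell'}$). With $v_{g_i}=1-(\hat g'_i\gg(\ell'-1))$, $P_b$ computes in $\mathbb Z_{2^\ell}$ $$\begin{aligned}\langle s_ig_i\rangle_b={}&b\,\hat s_i\hat g'_i+\hat s_iv_{g_i}\langle v_i\rangle_b2^{\ell'}-\hat s_i\langle r_{g_i}\rangle_b-b\,\hat s_i2^{\ell_f}+(1-2\hat s_i)\hat g'_i\langle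 r_{s_i}\rangle_b\\&+(1-2\hat s_i)v_{g_i}\langle m_i\rangle_b2^{\ell'}-(1-2\hat s_i)\bigl(\langle u_i\rangle_b+\langle r_{s_i}\rangle_b2^{\ell_f}\bigr)\end{aligned}$$ and outputs $\sum_i\langle s_ig_i\rangle_b$. The view of $P_b$ consists of the public parameters, its input shares, its keys, and the messages received from $P_{1-b}$. **Theorem.** 1. $\Pi_{\mathrm{Agg}}$ is secure against a static semi-honest adversary corrupting one of the two parties, for the functionality $f$ that outputs a fresh additive sharing over $\mathbb Z_{2^\ell}$ of $G=\sum_{i<N}s_ig_i$. That is, for each $b\in\{0,1\}$ there is a probabilistic simulator $\mathcal S_b$, one program for all parameters, running in time polynomial in the bit length $2N\ell$ of the input of $P_b$, such that for all parameters and inputs as above, with $(y_0,y_1)$ denoting the output of $f$, the pair $\bigl(\mathcal S_b(\text{parameters},\text{input of }P_b,\,y_b),\,(y_0,y_1)\bigr)$ has exactly the same distribution as (view of $P_b$, outputs of both parties) in an execution of $\Pi_{\mathrm{Agg}}$. In particular the two are computationally indistinguishable. 2. For each $b$ and all inputs, the keys $(\mathcal K_{b,i})_i$ of $P_b$ together with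 the opened values $(\hat s_i,\hat g'_i)_i$ are jointly uniform on $(\mathbb Z_{2^\ell}^5)^N\times(\mathbb Z_2\times\mathbb Z_{2^{\ell'}})^N$. So, given the keys, the opened values are perfectly simulated by uniform values of the same bit-widths, $1$ and $\ell_f+2$. -/

import Mathlib

/-! ### Probabilistic polynomial time

A probabilistic random-access machine on natural numbers, presented as a structured language with
bounded loops, with logarithmic cost: every evaluated subexpression costs one step plus the bit
length of its value, and every command and every loop iteration costs at least one step. Up to
a polynomial this is the time of a probabilistic Turing machine, and a machine with a
polynomial time bound can be run by a loop of polynomial length. -/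

namespace Ram

/-- The state: registers, an addressable memory, the read-only input, the output produced so far
and the time used so far. -/
structure State where
  reg : ℕ → ℕ
  mem : ℕ → ℕ
  inp : List ℕ
  out : List ℕ
  time : ℕ

/-- The start of a computation on the given input. -/
def State.init (input : List ℕ) : State where
  reg := fun _ => 0
  mem := fun _ => 0
  inp := input
  out := []
  time := 0

def State.tick (st : State) (n : ℕ) : State := { st with time := st.time + n }

inductive Expr where
  | lit (n : ℕ)
  | reg (x : ℕ)
  | inp (address : Expr)
  | mem (address : Expr)
  | add (a c : Expr)
  | sub (a c : Expr)
  | mul (a c : Expr)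
  | div (a c : Expr)
  | mod (a c : Expr)

def Expr.eval (st : State) : Expr → ℕ
  | .lit n => n
  | .reg x => st.reg x
  | .inp a => st.inp.getD (a.eval st) 0
  | .mem a => st.mem (a.eval st)
  | .add a c => a.eval st + c.eval st
  | .sub a c => a.eval st - c.eval st
  | .mul a c => a.eval st * c.eval st
  | .div a c => a.eval st / c.eval st
  | .mod a c => a.eval st % c.eval st

/-- `Nat.size n` is the number of binary digits of `n`. -/
def Expr.cost (st : State) : Expr → ℕ
  | .lit n => 1 + Nat.size n
  | .reg x => 1 + Nat.size (st.reg x)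
  | .inp a => a.cost st + 1 + Nat.size ((Expr.inp a).eval st)
  | .mem a => a.cost st + 1 + Nat.size ((Expr.mem a).eval st)
  | .add a c => a.cost st + c.cost st + 1 + Nat.size ((Expr.add a c).eval st)
  | .sub a c => a.cost st + c.cost st + 1 + Nat.size ((Expr.sub a c).eval st)
  | .mul a c => a.cost st + c.cost st + 1 + Nat.size ((Expr.mul a c).eval st)
  | .div a c => a.cost st + c.cost st + 1 + Nat.size ((Expr.div a c).eval st)
  | .mod a c => a.cost st + c.cost st + 1 + Nat.size ((Expr.mod a c).eval st)

/-- Programs. `flip x` puts a fresh fair coin into register `x`, `emit e` appends the value of `e`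
to the output, `cond e p q` runs `p` if `e` is not zero and `q` otherwise, and `loop e p`
evaluates `e` once and then runs `p` that many times. -/
inductive Prog where
  | skip
  | assign (x : ℕ) (e : Expr)
  | store (address e : Expr)
  | flip (x : ℕ)
  | emit (e : Expr)
  | seq (p q : Prog)
  | cond (e : Expr) (p q : Prog)
  | loop (e : Expr) (p : Prog)

/-- The distribution of the final state. -/
noncomputable def Prog.run : Prog → State → PMF State
  | .skip, st => PMF.pure (st.tick 1)
  | .assign x e, st =>
      PMF.pure { st.tick (1 + e.cost st) with reg := Function.update st.reg x (e.eval st) }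
  | .store a e, st =>
      PMF.pure { st.tick (1 + a.cost st + e.cost st) with
        mem := Function.update st.mem (a.eval st) (e.eval st) }
  | .flip x, st =>
      (PMF.uniformOfFintype (Fin 2)).map fun c =>
        { st.tick 1 with reg := Function.update st.reg x c.val }
  | .emit e, st => PMF.pure { st.tick (1 + e.cost st) with out := st.out ++ [e.eval st] }
  | .seq p q, st => (p.run st).bind q.run
  | .cond e p q, st =>
      if e.eval st ≠ 0 then p.run (st.tick (1 + e.cost st)) else q.run (st.tick (1 + e.cost st))
  | .loop e p, st =>
      (fun μ : PMF State => μ.bind fun t => p.run (t.tick 1))^[e.eval st]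
        (PMF.pure (st.tick (1 + e.cost st)))

/-- The distribution of the output on the given input. -/
noncomputable def Prog.output (p : Prog) (input : List ℕ) : PMF (List ℕ) :=
  (p.run (State.init input)).map State.out

/-- Whatever the coins, the program stops within `T` steps on the given input. -/
def Prog.StopsWithin (p : Prog) (input : List ℕ) (T : ℕ) : Prop :=
  ∀ t ∈ (p.run (State.init input)).support, t.time ≤ T

end Ram

/-! ### Semi-honest security of a two-party protocol -/

/-- Perfect security against a static semi-honest adversary who corrupts one of the parties
`P_0`, `P_1`. The index `i` ranges over the public parameters together with the inputs of both
parties, `input b i` is the input of `P_b` (with the public parameters), `size i` is its bit length,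
`f i` is the joint law of the two prescribed outputs, and `exec i` is the joint law of the two
views and the two outputs in an execution. For either `b` there has to be a probabilistic
polynomial-time simulator which, from the input and the prescribed output of `P_b` alone, makes up
a view of `P_b` such that the pair of simulated view and prescribed outputs has the same law as
the pair of real view and real outputs. Having the same law is indistinguishability with
advantage `0` for every adversary, and so implies computational indistinguishability. -/
def PrivatelyComputes {ι : Type} {Out : ι → Type} (size : ι → ℕ) (input : Fin 2 → ι → List ℕ)
    (encodeOut : ∀ i, Out i → List ℕ) (f : ∀ i, PMF (Fin 2 → Out i))
    (exec : ∀ i, PMF ((Fin 2 → List ℕ) × (Fin 2 → Out i))) : Prop :=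
  ∃ S : Fin 2 → Ram.Prog, ∀ b : Fin 2,
    (∃ T : Polynomial ℕ, ∀ i, ∀ y : Out i,
      (S b).StopsWithin (input b i ++ encodeOut i y) (T.eval (size i))) ∧
    ∀ i,
      ((f i).bind fun y =>
        ((S b).output (input b i ++ encodeOut i (y b))).map fun view => (view, y)) =
      (exec i).map fun e => (e.1 b, e.2)

/-! ### The aggregation protocol -/

namespace Agg

/-- `n`-bit words, with arithmetic modulo `2 ^ n`. The number `x mod 2 ^ m` is obtained from a word
`x` by casting its representative `x.val`, which lies in `[0, 2 ^ n)`. -/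
abbrev Word (n : ℕ) : Type := ZMod (2 ^ n)

/-- Additive sharing of `x` with randomness `ρ`; entry `b` belongs to `P_b`. -/
def share {n : ℕ} (x ρ : Word n) : Fin 2 → Word n := ![x - ρ, ρ]

/-- Public parameters, and shares of indicator bits `s_i` and of `lf`-bit signed numbers `g_i`:
`s b i` and `g b i` are the shares that `P_b` holds. -/
structure Instance where
  l : ℕ
  lf : ℕ
  N : ℕ
  N_pos : 0 < N
  lf_le : lf + 2 ≤ l
  s : Fin 2 → Fin N → Word l
  g : Fin 2 → Fin N → Word l
  s_bit : ∀ i, s 0 i + s 1 i = 0 ∨ s 0 i + s 1 i = 1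
  g_range : ∀ i, ∃ z : ℤ, -2 ^ lf ≤ z ∧ z ≤ 2 ^ lf - 1 ∧ g 0 i + g 1 i = (z : Word l)

/-- One party's share of the correlated randomness for one index, in the order
`r_s, r_g, u, v, m`. -/
abbrev Key (l : ℕ) : Type := Fin 5 → Word l

/-- The pair consisting of a bit (for the indicator) and of an `(lf + 2)`-bit word (for the
gradient), as it is sent by a party and as it is opened. -/
abbrev Masked (lf : ℕ) : Type := Word 1 × Word (lf + 2)

/-- The randomness of the dealer for one index: the masks `r_s` and `r_g`, and the randomness of
the five sharings. -/
abbrev Coins (l lf : ℕ) : Type := Word 1 × Word (lf + 2) × (Fin 5 → Word l)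

/-- The values which the dealer shares over `l`-bit words, for the masks `r_s` and `r_g`:
`r_s`, `r_g`, `u = r_s * r_g`, the top bit `v` of `r_g`, and `m = r_s * v`. -/
def dealt (l : ℕ) {lf : ℕ} (rs : Word 1) (rg : Word (lf + 2)) : Fin 5 → Word l :=
  let v : ℕ := rg.val >>> (lf + 1)
  ![(rs.val : Word l), (rg.val : Word l), ((rs.val * rg.val : ℕ) : Word l), (v : Word l),
    ((rs.val * v : ℕ) : Word l)]

/-- Offline phase: the key which the dealer sends to `P_b`. -/
def key {l lf : ℕ} (c : Coins l lf) (b : Fin 2) : Key l :=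
  fun j => share (dealt l c.1 c.2.1 j) (c.2.2 j) b

/-- Online phase: what a party with shares `s`, `g` and key `k` sends to the other one, namely
`(s mod 2) + r_s mod 2` and `g + r_g mod 2 ^ (lf + 2)`, on shares. -/
def send {l : ℕ} (lf : ℕ) (s g : Word l) (k : Key l) : Masked lf :=
  ((s.val : Word 1) + ((k 0).val : Word 1), ((g + k 1).val : Word (lf + 2)))

/-- Opening, from the two messages: the bit `s ⊕ r_s`, and `g' + r_g mod 2 ^ (lf + 2)` for
the biased, hence nonnegative, gradient `g' = g + 2 ^ lf`. -/
def reveal {lf : ℕ} (x y : Masked lf) : Masked lf :=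
  (x.1 + y.1, x.2 + y.2 + 2 ^ lf)

/-- The share of `s * g` which `P_b` computes from the opened values and its key. Here
`s = ŝ + (1 - 2 ŝ) r_s` and `g = ĝ + 2 ^ (lf + 2) v_g v - r_g - 2 ^ lf`, where `v_g` is the
negation of the top bit of `ĝ`; the product is linear in the shared values, and a public summand
`c` is shared as `b * c`. -/
def productShare {l lf : ℕ} (b : Fin 2) (opened : Masked lf) (k : Key l) : Word l :=
  let sh : Word l := (opened.1.val : Word l)
  let gh : Word l := (opened.2.val : Word l)
  let vg : Word l := ((1 - opened.2.val >>> (lf + 1) : ℕ) : Word l)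
  let bb : Word l := (b.val : Word l)
  bb * (sh * gh) + sh * vg * k 3 * 2 ^ (lf + 2) - sh * k 1 - bb * (sh * 2 ^ lf)
    + (1 - 2 * sh) * gh * k 0 + (1 - 2 * sh) * vg * k 4 * 2 ^ (lf + 2)
    - (1 - 2 * sh) * (k 2 + k 0 * 2 ^ lf)

namespace Instance

variable (I : Instance)

/-- The bit length of the input of a party: `2 N` words of `l` bits. -/
def size : ℕ := 2 * I.N * I.l

/-- The input of `P_b`, preceded by the public parameters. -/
def input (b : Fin 2) : List ℕ :=
  [I.l, I.lf, I.N] ++ List.ofFn (fun i => (I.s b i).val) ++ List.ofFn (fun i => (I.g b i).val)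

/-- The prescribed outputs: a fresh additive sharing of `∑ s_i * g_i` over `l`-bit words. -/
noncomputable def ideal : PMF (Fin 2 → Word I.l) :=
  (PMF.uniformOfFintype (Word I.l)).map
    (share (∑ i, (I.s 0 i + I.s 1 i) * (I.g 0 i + I.g 1 i)))

/-- The message of `P_b` for index `i`. -/
def message (c : Fin I.N → Coins I.l I.lf) (b : Fin 2) (i : Fin I.N) : Masked I.lf :=
  send I.lf (I.s b i) (I.g b i) (key (c i) b)

/-- The values opened for index `i`. -/
def opened (c : Fin I.N → Coins I.l I.lf) (i : Fin I.N) : Masked I.lf :=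
  reveal (I.message c 0 i) (I.message c 1 i)

/-- The output of `P_b`. -/
def result (c : Fin I.N → Coins I.l I.lf) (b : Fin 2) : Word I.l :=
  ∑ i, productShare b (I.opened c i) (key (c i) b)

/-- The view of `P_b`: its input and, for each index, its key (the message of the dealer) and the
message of the other party. The parties toss no coins of their own. -/
def view (c : Fin I.N → Coins I.l I.lf) (b : Fin 2) : List ℕ :=
  I.input b ++ (List.finRange I.N).flatMap fun i =>
    List.ofFn (fun j => (key (c i) b j).val) ++
      [(I.message c (1 - b) i).1.val, (I.message c (1 - b) i).2.val]

/-- The dealer's coins: all masks and all sharings uniform and independent, and independent of the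
inputs. -/
noncomputable def coins : PMF (Fin I.N → Coins I.l I.lf) :=
  PMF.uniformOfFintype (Fin I.N → Coins I.l I.lf)

/-- The views and the outputs of the two parties in an execution. -/
noncomputable def exec : PMF ((Fin 2 → List ℕ) × (Fin 2 → Word I.l)) :=
  I.coins.map fun c => (I.view c, I.result c)

end Instance

end Agg

/-! ### Uniform distributions -/

/-! Fix the inputs and a party `P_b`. Each opened value is a translate of a mask by a quantity that
depends only on the inputs, so it determines the mask; once the masks are known, so are the dealt
values, and the key of `P_b` then determines the randomness of the sharings. Thus the dealer's coins
correspond bijectively to the tuple q of keys and opened values (`bijective_key_opened`), which is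
therefore uniform. This is the second claim.

The received message is the opened value minus the party's own message, so the view is a function of
q, and so is the output of `P_b`. By correctness (`productShare_add`) the other output is the total
minus that one. Correctness rests on `unmask`: the biased gradient is less than half the modulus, so
the carry can be read off two top bits. The real law is thus that of (view, sharing) as a function
of uniform q (`exec_eq`).

A simulator given y has to draw q uniformly among the tuples with output y, exactly, from fair
coins. The share of u enters each product share with coefficient ±1, so it can be solved for. The
tuple is encoded by one number X, cut into blocks, in which an l-bit digit takes the place of the
share of u; this share is chosen so that the product share is the lowest digit of the block minus
that of the next one. The sum telescopes to the lowest digit of X, which is set to y, and all other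
digits are fair coins. The encoding is a bijection from pairs (y, coins) onto tuples q
(`bijective_blocks_seed`), and the prescribed y is uniform, so the two laws agree (`simulation`).

Finally, a concrete program realises this sampler (`samples_simulator`). Its loops are not nested,
they make O(size) passes, and all numbers have O(size) bits, so the time is quadratic. -/

theorem PMF.map_uniformOfFintype_of_bijective {α β : Type*} [Fintype α] [Nonempty α] [Fintype β]
    [Nonempty β] {f : α → β} (hf : Function.Bijective f) :
    (PMF.uniformOfFintype α).map f = PMF.uniformOfFintype β := by
  classical
  ext b
  obtain ⟨a, rfl⟩ := hf.2 b
  rw [PMF.map_apply, tsum_eq_single a]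
  · simp [Fintype.card_of_bijective hf]
  · intro a' ha'
    rw [if_neg fun h => ha' (hf.1 h.symm)]

/-- Two successive independent uniform draws are one uniform draw of a pair. It serves both for
joining digits inside the sampler and for joining the prescribed output with the simulator's coins.
-/
theorem PMF.bind_map_uniformOfFintype {α β γ : Type*} [Fintype α] [Nonempty α] [Fintype β]
    [Nonempty β] (f : α → β → γ) :
    ((PMF.uniformOfFintype α).bind fun a => (PMF.uniformOfFintype β).map (f a)) =
      (PMF.uniformOfFintype (α × β)).map fun q => f q.1 q.2 := by
  classical
  ext c
  simp only [PMF.bind_apply, PMF.map_apply, tsum_fintype, PMF.uniformOfFintype_apply,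
    Fintype.sum_prod_type, Finset.mul_sum, Fintype.card_prod, Nat.cast_mul]
  refine Finset.sum_congr rfl fun a _ => Finset.sum_congr rfl fun b _ => ?_
  split_ifs
  · rw [ENNReal.mul_inv] <;> simp
  · simp

/-! ### Reasoning about programs -/

namespace Ram

/-- The same state with another clock. -/
def State.withTime (s : State) (n : ℕ) : State := { s with time := n }

-- Programs cannot read the clock, so runs can be described by states up to the clock, with time
-- bounded separately.
@[simp] theorem Expr.eval_withTime (s : State) (n : ℕ) (e : Expr) :
    e.eval (s.withTime n) = e.eval s := by
  induction e <;> simp_all [Expr.eval, State.withTime]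

@[simp] theorem Expr.cost_withTime (s : State) (n : ℕ) (e : Expr) :
    e.cost (s.withTime n) = e.cost s := by
  induction e with
  | lit | reg => simp [Expr.cost, State.withTime]
  | _ => simp_all only [Expr.cost, Expr.eval_withTime]

/-- All numbers stored in the state have at most `K` binary digits. -/
structure State.SizeLE (s : State) (K : ℕ) : Prop where
  pos : 1 ≤ K
  reg : ∀ x, Nat.size (s.reg x) ≤ K
  mem : ∀ a, Nat.size (s.mem a) ≤ K
  inp : ∀ a, Nat.size (s.inp.getD a 0) ≤ K

/-- Bounds the size of the value of an expression, relative to the size of the numbers in the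
state. -/
def Expr.width : Expr → ℕ
  | .lit n => Nat.size n
  | .reg _ | .inp _ | .mem _ => 1
  | .add a c | .mul a c => a.width + c.width + 1
  | .sub a _ | .div a _ | .mod a _ => a.width

/-- A product adds bit lengths and a sum gains at most one bit, so the length stays linear in `K`
with a coefficient depending on the expression only. -/
theorem Expr.size_eval_le {s : State} {K : ℕ} (hs : s.SizeLE K) (e : Expr) :
    Nat.size (e.eval s) ≤ e.width * K := by
  have hK := hs.pos
  induction e with
  | lit n => exact Nat.le_mul_of_pos_right _ hK
  | reg x => rw [Expr.width, one_mul]; exact hs.reg x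
  | inp a => rw [Expr.width, one_mul]; exact hs.inp _
  | mem a => rw [Expr.width, one_mul]; exact hs.mem _
  | add a c iha ihc =>
    rw [Expr.eval, Expr.width, Nat.size_le]
    have ha := Nat.size_le.1 (iha.trans (Nat.mul_le_mul_right K (Nat.le_add_right _ c.width)))
    have hc := Nat.size_le.1 (ihc.trans (Nat.mul_le_mul_right K (Nat.le_add_left _ a.width)))
    calc _ < 2 ^ ((a.width + c.width) * K + 1) := by rw [pow_succ]; omega
      _ ≤ _ := Nat.pow_le_pow_right two_pos (by rw [add_mul _ 1]; omega)
  | mul a c iha ihc =>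
    rw [Expr.eval, Expr.width, Nat.size_le]
    calc _ < 2 ^ (a.width * K) * 2 ^ (c.width * K) :=
          Nat.mul_lt_mul'' (Nat.size_le.1 iha) (Nat.size_le.1 ihc)
      _ ≤ _ := by
          rw [← pow_add]
          exact Nat.pow_le_pow_right two_pos (by rw [add_mul _ 1, add_mul]; omega)
  | sub a c iha ihc => exact (Nat.size_le_size (Nat.sub_le _ _)).trans iha
  | div a c iha ihc => exact (Nat.size_le_size (Nat.div_le_self _ _)).trans iha
  | mod a c iha ihc => exact (Nat.size_le_size (Nat.mod_le _ _)).trans iha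

/-- Bounds the cost of an expression, relative to the size of the numbers in the state. -/
def Expr.weight : Expr → ℕ
  | .lit n => 1 + Nat.size n
  | .reg _ => 2
  | .inp a | .mem a => a.weight + 2
  | .add a c => a.weight + c.weight + 1 + (Expr.add a c).width
  | .mul a c => a.weight + c.weight + 1 + (Expr.mul a c).width
  | .sub a c => a.weight + c.weight + 1 + (Expr.sub a c).width
  | .div a c => a.weight + c.weight + 1 + (Expr.div a c).width
  | .mod a c => a.weight + c.weight + 1 + (Expr.mod a c).width

theorem Expr.cost_le {s : State} {K : ℕ} (hs : s.SizeLE K) (e : Expr) :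
    e.cost s ≤ e.weight * K := by
  have hK := hs.pos
  have h := fun e => Expr.size_eval_le hs e
  induction e with
  | lit n => exact Nat.le_mul_of_pos_right _ hK
  | reg x => have := hs.reg x; rw [Expr.cost, Expr.weight]; omega
  | inp a iha | mem a iha =>
    have := h (.inp a); have := h (.mem a)
    simp only [Expr.cost, Expr.weight, Expr.width, add_mul] at *; omega
  | add a c iha ihc => have := h (.add a c); simp only [Expr.cost, Expr.weight, add_mul]; omega
  | mul a c iha ihc => have := h (.mul a c); simp only [Expr.cost, Expr.weight, add_mul]; omega
  | sub a c iha ihc => have := h (.sub a c); simp only [Expr.cost, Expr.weight, add_mul]; omega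
  | div a c iha ihc => have := h (.div a c); simp only [Expr.cost, Expr.weight, add_mul]; omega
  | mod a c iha ihc => have := h (.mod a c); simp only [Expr.cost, Expr.weight, add_mul]; omega

/-- Started in `s`, the program `p` takes at most `n` steps and ends in a state that depends on a
uniformly distributed element `a` and that is `F a`, up to the clock. -/
def Samples (p : Prog) (n : ℕ) (s : State) (α : Type) [Fintype α] [Nonempty α] (F : α → State) :
    Prop :=
  ∀ τ, ∃ τ' : α → ℕ, (∀ a, τ' a ≤ τ + n) ∧
    p.run (s.withTime τ) = (PMF.uniformOfFintype α).map fun a => (F a).withTime (τ' a)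

/-- Started in `s`, the program `p` takes at most `n` steps and ends in `s'`, up to the clock. -/
def Leads (p : Prog) (n : ℕ) (s s' : State) : Prop :=
  ∀ τ, ∃ τ' ≤ τ + n, p.run (s.withTime τ) = PMF.pure (s'.withTime τ')

section

variable {p q : Prog} {m n : ℕ} {s s' s'' : State} {α : Type} [Fintype α] [Nonempty α]
  {F F' : α → State}

theorem Leads.mono (h : Leads p n s s') (hn : n ≤ m) : Leads p m s s' := fun τ =>
  let ⟨τ', hτ, h'⟩ := h τ
  ⟨τ', by omega, h'⟩

theorem Samples.mono (h : Samples p n s α F) (hn : n ≤ m) : Samples p m s α F := fun τ =>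
  let ⟨τ', hτ, h'⟩ := h τ
  ⟨τ', fun a => (hτ a).trans (by omega), h'⟩

theorem Leads.seq (hp : Leads p n s s') (hq : Leads q m s' s'') :
    Leads (p.seq q) (n + m) s s'' := by
  intro τ
  obtain ⟨τ₁, h₁, hp⟩ := hp τ
  obtain ⟨τ₂, h₂, hq⟩ := hq τ₁
  exact ⟨τ₂, by omega, by rw [Prog.run, hp, PMF.pure_bind, hq]⟩

theorem Leads.seq_samples (hp : Leads p n s s') (hq : Samples q m s' α F) :
    Samples (p.seq q) (n + m) s α F := by
  intro τ
  obtain ⟨τ₁, h₁, hp⟩ := hp τ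
  obtain ⟨τ₂, h₂, hq⟩ := hq τ₁
  exact ⟨τ₂, fun a => (h₂ a).trans (by omega), by rw [Prog.run, hp, PMF.pure_bind, hq]⟩

theorem Samples.seq_leads (hp : Samples p n s α F) (hq : ∀ a, Leads q m (F a) (F' a)) :
    Samples (p.seq q) (n + m) s α F' := by
  intro τ
  obtain ⟨τ₁, h₁, hp⟩ := hp τ
  choose τ₂ h₂ hq using fun a => hq a (τ₁ a)
  refine ⟨τ₂, fun a => (h₂ a).trans (by have := h₁ a; omega), ?_⟩
  rw [Prog.run, hp, PMF.bind_map]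
  simp only [Function.comp_def, hq]
  rfl

theorem leads_assign (x : ℕ) (e : Expr) (s : State) :
    Leads (.assign x e) (1 + e.cost s) s { s with reg := Function.update s.reg x (e.eval s) } :=
  fun τ => ⟨τ + (1 + e.cost s), le_rfl, by
    simp only [Prog.run, Expr.eval_withTime, Expr.cost_withTime]; rfl⟩

theorem leads_emit (e : Expr) (s : State) :
    Leads (.emit e) (1 + e.cost s) s { s with out := s.out ++ [e.eval s] } :=
  fun τ => ⟨τ + (1 + e.cost s), le_rfl, by
    simp only [Prog.run, Expr.eval_withTime, Expr.cost_withTime]; rfl⟩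

/-- The family `σ` is the loop invariant: `σ i` is the state after `i` passes. The `n + 1` includes
the tick of each pass. -/
theorem Leads.loop {σ : ℕ → State} (e : Expr)
    (h : ∀ i < e.eval (σ 0), Leads p n (σ i) (σ (i + 1))) :
    Leads (.loop e p) (1 + e.cost (σ 0) + e.eval (σ 0) * (n + 1)) (σ 0) (σ (e.eval (σ 0))) := by
  intro τ
  have key : ∀ k ≤ e.eval (σ 0), ∃ τ' ≤ τ + (1 + e.cost (σ 0)) + k * (n + 1),
      (fun μ : PMF State => μ.bind fun t => p.run (t.tick 1))^[k]
        (PMF.pure ((σ 0).withTime (τ + (1 + e.cost (σ 0))))) = PMF.pure ((σ k).withTime τ') := by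
    intro k
    induction k with
    | zero => exact fun _ => ⟨_, by omega, rfl⟩
    | succ k ih =>
      intro hk
      obtain ⟨τ₁, h₁, ih⟩ := ih (by omega)
      obtain ⟨τ₂, h₂, hp⟩ := h k (by omega) (τ₁ + 1)
      refine ⟨τ₂, by rw [add_mul k]; omega, ?_⟩
      rw [Function.iterate_succ_apply', ih, PMF.pure_bind]
      exact hp
  obtain ⟨τ', h', key⟩ := key _ le_rfl
  refine ⟨τ', by omega, ?_⟩
  rw [Prog.run, Expr.eval_withTime, Expr.cost_withTime, ← key]
  rfl

/-- A loop which draws the binary digits of a uniform number in register `x`, by way of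
register `y`. -/
def Prog.draw (x y : ℕ) (e : Expr) : Prog :=
  .loop e (.seq (.flip y) (.assign x (.add (.mul (.lit 2) (.reg x)) (.reg y))))

/-- The state with the values `a` and `c` in the registers `x` and `y`. -/
def State.set₂ (s : State) (x y a c : ℕ) : State :=
  { s with reg := Function.update (Function.update s.reg y c) x a }

theorem State.SizeLE.set₂ {K : ℕ} (hs : s.SizeLE K) (x y : ℕ) {a c : ℕ} (ha : Nat.size a ≤ K)
    (hc : Nat.size c ≤ K) : (s.set₂ x y a c).SizeLE K where
  pos := hs.pos
  reg z := by
    simp only [State.set₂, Function.update_apply]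
    split_ifs
    exacts [ha, hc, hs.reg z]
  mem := hs.mem
  inp := hs.inp

/-- Each pass appends a coin as the new last binary digit; the coin register thus ends with the
parity of the drawn number. The condition `e.eval s < K` keeps all intermediate numbers within `K`
bits. -/
theorem samples_draw {x y K : ℕ} (hxy : x ≠ y) (e : Expr) (hx : s.reg x = 0) (hy : s.reg y = 0)
    (hs : s.SizeLE K) (hK : e.eval s < K) :
    Samples (.draw x y e) (1 + e.cost s + e.eval s * (22 * K)) s (Fin (2 ^ e.eval s))
      fun r => s.set₂ x y r (r % 2) := by
  intro τ
  set a : Expr := .add (.mul (.lit 2) (.reg x)) (.reg y) with ha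
  have key : ∀ k ≤ e.eval s, ∃ τ' : Fin (2 ^ k) → ℕ,
      (∀ r, τ' r ≤ τ + (1 + e.cost s) + k * (22 * K)) ∧
      (fun μ : PMF State => μ.bind fun t => (Prog.seq (.flip y) (.assign x a)).run (t.tick 1))^[k]
        (PMF.pure (s.withTime (τ + (1 + e.cost s)))) =
      (PMF.uniformOfFintype (Fin (2 ^ k))).map fun r : Fin (2 ^ k) =>
        (s.set₂ x y r (r % 2)).withTime (τ' r) := by
    intro k
    induction k with
    | zero =>
      refine fun _ => ⟨fun _ => _, fun _ => (by omega : τ + (1 + e.cost s) ≤ _), ?_⟩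
      -- Before any pass the number drawn is 0, so both registers must already hold 0.
      have h0 : ∀ r : Fin (2 ^ 0), s.set₂ x y r (r % 2) = s := by
        intro r
        have : (r : ℕ) = 0 := by have := r.2; omega
        rw [State.set₂, this, Nat.zero_mod, ← hy, Function.update_eq_self, hy, ← hx,
          Function.update_eq_self]
      simp only [h0]
      exact (PMF.map_const _ _).symm
    | succ k ih =>
      intro hk
      obtain ⟨τ₁, h₁, ih⟩ := ih (by omega)
      let t : Fin (2 ^ k) → Fin 2 → State := fun r c => s.set₂ x y r c
      have hcost : ∀ r c, a.cost (t r c) ≤ 19 * K := fun r c => by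
        have hr : Nat.size (r : ℕ) ≤ K := (Nat.size_le.2 r.2).trans (by omega)
        have hc : Nat.size (c : ℕ) ≤ K :=
          (Nat.size_le.2 (c.2.trans_eq (pow_one 2).symm)).trans (by omega)
        exact (Expr.cost_le (hs.set₂ x y hr hc) a).trans_eq
          (congrArg (· * K) (by
            simp [ha, Expr.weight, Expr.width, (by decide : Nat.size 2 = 2)]))
      -- Appending a digit, (r, c) ↦ 2r + c, is a bijection, so uniformity passes from `k` to `k +
      -- 1` digits.
      let φ : Fin (2 ^ k) × Fin 2 ≃ Fin (2 ^ (k + 1)) :=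
        finProdFinEquiv.trans (finCongr (pow_succ 2 k).symm)
      have hφ : ∀ q, (φ q : ℕ) = 2 * q.1 + q.2 := fun q => by simp [φ]; ring
      -- The 3 counts one step each for the pass, the coin and the assignment. With the expression
      -- cost of at most 19 `K` this gives the 22 `K` per pass.
      refine ⟨fun r => τ₁ (φ.symm r).1 + 3 + a.cost (t (φ.symm r).1 (φ.symm r).2), fun r => ?_, ?_⟩
      · have := h₁ (φ.symm r).1
        have := hcost (φ.symm r).1 (φ.symm r).2
        have := hs.pos
        rw [add_mul k]; dsimp only; omega
      · rw [Function.iterate_succ_apply', ih, PMF.bind_map,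
          ← PMF.map_uniformOfFintype_of_bijective φ.bijective, PMF.map_comp]
        refine Eq.trans (Eq.trans ?_ (PMF.bind_map_uniformOfFintype fun r c =>
          (s.set₂ x y (φ (r, c)) (φ (r, c) % 2)).withTime (τ₁ r + 3 + a.cost (t r c)))) ?_
        · congr 1
          funext r
          simp only [Function.comp_def, Prog.run, PMF.bind_map]
          refine congrArg (PMF.bind _) (funext fun c => congrArg PMF.pure ?_)
          have hu : ({ (((s.set₂ x y r (r % 2)).withTime (τ₁ r)).tick 1).tick 1 with
              reg := Function.update (((s.set₂ x y r (r % 2)).withTime (τ₁ r)).tick 1).reg y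
                c.val } : State) = (t r c).withTime (τ₁ r + 2) := by
            simp only [State.set₂, State.withTime, State.tick, t]
            rw [Function.update_comm hxy, Function.update_idem]
          have hm : (φ (r, c) : ℕ) % 2 = c := by rw [hφ]; have := c.2; dsimp only; omega
          have he : a.eval (t r c) = φ (r, c) := by
            simp [ha, Expr.eval, t, State.set₂, hφ, Function.update_of_ne hxy.symm]
          have hu' : ({ (((s.set₂ x y r (r % 2)).withTime (τ₁ r)).tick 1).tick 1 with
              reg := Function.update (((s.set₂ x y r (r % 2)).withTime (τ₁ r)).tick 1).reg y
                c.val } : State) = (t r c).withTime (τ₁ r + 2) := hu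
          simp only [hu, Expr.eval_withTime, Expr.cost_withTime, he, hm]
          simp only [State.withTime, State.tick, State.set₂, t]
          rw [Function.update_comm hxy, Function.update_idem, Function.update_idem]
          congr 1
          omega
        · congr 1
          funext q
          simp
  obtain ⟨τ', h', key⟩ := key _ le_rfl
  refine ⟨τ', fun r => by have := h' r; omega, ?_⟩
  rw [Prog.draw, Prog.run, Expr.eval_withTime, Expr.cost_withTime, ← key]
  rfl

end

/-! ### Time bounds -/

/-- Bounds the time of a program, relative to the size of the numbers that occur. -/
def Prog.weight : Prog → ℕ
  | .skip | .flip _ => 1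
  | .assign _ e | .emit e => 1 + e.weight
  | .store a e => 1 + a.weight + e.weight
  | .seq p q => p.weight + q.weight
  | .cond e p q => 1 + e.weight + p.weight + q.weight
  | .loop e p => 2 + e.weight + p.weight

section

variable {p q : Prog} {K u x y : ℕ} {e : Expr} {s s' s'' : State} {α : Type} [Fintype α]
  [Nonempty α] {F F' : α → State}

theorem Leads.seq_weight (hp : Leads p (p.weight * u) s s') (hq : Leads q (q.weight * u) s' s'') :
    Leads (p.seq q) ((p.seq q).weight * u) s s'' :=
  (hp.seq hq).mono (add_mul _ _ _).ge

theorem Leads.seq_samples_weight (hp : Leads p (p.weight * u) s s')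
    (hq : Samples q (q.weight * u) s' α F) :
    Samples (p.seq q) ((p.seq q).weight * u) s α F :=
  (hp.seq_samples hq).mono (add_mul _ _ _).ge

theorem Samples.seq_leads_weight (hp : Samples p (p.weight * u) s α F)
    (hq : ∀ a, Leads q (q.weight * u) (F a) (F' a)) :
    Samples (p.seq q) ((p.seq q).weight * u) s α F' :=
  (hp.seq_leads hq).mono (add_mul _ _ _).ge

theorem leads_assign_weight (hs : s.SizeLE K)
    (h : { s with reg := Function.update s.reg x (e.eval s) } = s') :
    Leads (.assign x e) ((Prog.assign x e).weight * K) s s' := by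
  subst h
  refine (leads_assign x e s).mono ?_
  rw [Prog.weight, add_mul, one_mul]
  exact add_le_add hs.pos (Expr.cost_le hs e)

theorem leads_emit_weight (hs : s.SizeLE K) (h : { s with out := s.out ++ [e.eval s] } = s') :
    Leads (.emit e) ((Prog.emit e).weight * K) s s' := by
  subst h
  refine (leads_emit e s).mono ?_
  rw [Prog.weight, add_mul, one_mul]
  exact add_le_add hs.pos (Expr.cost_le hs e)

/-- Brings straight-line code to the quadratic unit used for loops, so that weights can be added. -/
theorem Leads.square (h : Leads p (p.weight * K) s s') :
    Leads p (p.weight * K ^ 2) s s' :=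
  h.mono (Nat.mul_le_mul_left _ (Nat.le_self_pow two_ne_zero K))

theorem Leads.loop_weight {σ : ℕ → State} {k : ℕ} (hs : (σ 0).SizeLE K) (he : e.eval (σ 0) = k)
    (hk : k ≤ K) (h : ∀ i < k, Leads p (p.weight * K) (σ i) (σ (i + 1))) :
    Leads (.loop e p) ((Prog.loop e p).weight * K ^ 2) (σ 0) (σ k) := by
  subst he
  refine (Leads.loop e h).mono ?_
  have hK := hs.pos
  have hc := Expr.cost_le hs e
  rw [Prog.weight]
  calc _ ≤ 1 + e.weight * K + K * (p.weight * K + 1) := by gcongr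
    _ ≤ 1 * K ^ 2 + e.weight * K ^ 2 + (p.weight * K ^ 2 + K ^ 2) := by
      have := Nat.le_self_pow two_ne_zero K
      gcongr
      · omega
      · rw [mul_add, mul_one, sq]
        exact add_le_add (by rw [mul_left_comm]) (Nat.le_mul_of_pos_left _ hK)
    _ = _ := by ring

theorem samples_draw_weight (hxy : x ≠ y) (hx : s.reg x = 0) (hy : s.reg y = 0)
    (hs : s.SizeLE K) {k : ℕ} (he : e.eval s = k) (hk : k < K) :
    Samples (.draw x y e) ((Prog.draw x y e).weight * K ^ 2) s (Fin (2 ^ k))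
      fun r => s.set₂ x y r (r % 2) := by
  subst he
  refine (samples_draw hxy e hx hy hs hk).mono ?_
  have hc := Expr.cost_le hs e
  have hw : (Prog.draw x y e).weight = 23 + e.weight := by
    simp [Prog.draw, Prog.weight, Expr.weight, Expr.width, (by decide : Nat.size 2 = 2)]
    omega
  rw [hw]
  calc _ ≤ 1 + e.weight * K + K * (22 * K) := by gcongr
    _ ≤ 1 * K ^ 2 + e.weight * K ^ 2 + K * (22 * K) := by
      have := Nat.le_self_pow two_ne_zero K
      gcongr
      omega
    _ = _ := by ring

end

/-- A loop which puts a power of two into register `x`. -/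
def Prog.pow (x : ℕ) (e : Expr) : Prog :=
  .seq (.assign x (.lit 1)) (.loop e (.assign x (.mul (.lit 2) (.reg x))))

theorem leads_pow {x K k : ℕ} {e : Expr} {s : State} (hs : s.SizeLE K) (hk : k < K)
    (he : e.eval { s with reg := Function.update s.reg x 1 } = k) :
    Leads (.pow x e) ((Prog.pow x e).weight * K ^ 2) s
      { s with reg := Function.update s.reg x (2 ^ k) } := by
  let σ : ℕ → State := fun i => { s with reg := Function.update s.reg x (2 ^ i) }
  have hσ : ∀ i ≤ k, (σ i).SizeLE K := fun i hi => {
    pos := hs.pos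
    reg := fun z => by
      simp only [σ, Function.update_apply]
      split_ifs
      exacts [Nat.size_pow.trans_le (by omega), hs.reg z]
    mem := hs.mem
    inp := hs.inp }
  refine Leads.seq_weight ((leads_assign_weight (s' := σ 0) hs rfl).square) ?_
  refine Leads.loop_weight (σ := σ) (hσ 0 (Nat.zero_le k)) he hk.le fun i hi =>
    leads_assign_weight (hσ i hi.le) ?_
  simp [σ, Expr.eval, pow_succ']

theorem Samples.output_eq {p : Prog} {n : ℕ} {input : List ℕ} {α : Type} [Fintype α] [Nonempty α]
    {F : α → State} (h : Samples p n (State.init input) α F) :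
    p.output input = (PMF.uniformOfFintype α).map fun a => (F a).out := by
  obtain ⟨τ', -, h⟩ := h 0
  rw [Prog.output]
  refine (congrArg (PMF.map State.out) h).trans ?_
  rw [PMF.map_comp]
  rfl

theorem Samples.stopsWithin {p : Prog} {n : ℕ} {input : List ℕ} {α : Type} [Fintype α]
    [Nonempty α] {F : α → State} (h : Samples p n (State.init input) α F) :
    p.StopsWithin input n := by
  obtain ⟨τ', hτ, h⟩ := h 0
  intro t ht
  have ht : t ∈ (p.run ((State.init input).withTime 0)).support := ht
  rw [h, PMF.support_map] at ht
  obtain ⟨a, -, rfl⟩ := ht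
  exact (hτ a).trans_eq (zero_add n)

end Ram

/-! ### Masking, opening and correctness of the product -/

namespace Agg

variable {l lf : ℕ}

theorem two_dvd_two_pow (h : lf + 2 ≤ l) : 2 ^ 1 ∣ 2 ^ l := pow_dvd_pow 2 (by omega)

theorem cast_val {m n : ℕ} (h : 2 ^ m ∣ 2 ^ n) (x : Word n) :
    (x.val : Word m) = ZMod.castHom h (Word m) x := by
  rw [ZMod.castHom_apply, ZMod.natCast_val]

theorem share_add {n : ℕ} (x ρ : Word n) : share x ρ 0 + share x ρ 1 = x := by
  simp [share]

theorem share_injective {n : ℕ} (x : Word n) (b : Fin 2) :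
    Function.Injective fun ρ => share x ρ b := by
  fin_cases b
  · exact sub_right_injective
  · exact Function.injective_id

theorem key_add (c : Coins l lf) (j : Fin 5) :
    key c 0 j + key c 1 j = dealt l c.1 c.2.1 j := share_add _ _

/-- Reduction from modulus 2^l to a smaller power of two is a ring homomorphism, so the two messages
can be added before reducing, and the shares recombine. -/
theorem reveal_send (h : lf + 2 ≤ l) (s g : Fin 2 → Word l) (c : Coins l lf) :
    reveal (send lf (s 0) (g 0) (key c 0)) (send lf (s 1) (g 1) (key c 1)) =
      (((s 0 + s 1).val : Word 1) + c.1, ((g 0 + g 1).val : Word (lf + 2)) + c.2.1 + 2 ^ lf) := by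
  have h1 := two_dvd_two_pow h
  have h2 : 2 ^ (lf + 2) ∣ 2 ^ l := pow_dvd_pow 2 h
  have e0 := congrArg (ZMod.castHom h1 (Word 1)) (key_add c 0)
  have e1 := congrArg (ZMod.castHom h2 (Word (lf + 2))) (key_add c 1)
  simp only [dealt, Matrix.cons_val_zero, Matrix.cons_val_one, map_natCast, map_add,
    ZMod.natCast_zmod_val] at e0 e1
  simp only [reveal, send, cast_val h1, cast_val h2, map_add, ← e0, ← e1]
  ext <;> simp only <;> ring

/-- The key of one party and the opened values determine the dealer's coins. -/
theorem key_reveal_injective (h : lf + 2 ≤ l) (s g : Fin 2 → Word l) (b : Fin 2) :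
    Function.Injective fun c : Coins l lf =>
      (key c b, reveal (send lf (s 0) (g 0) (key c 0)) (send lf (s 1) (g 1) (key c 1))) := by
  rintro ⟨rs, rg, ρ⟩ ⟨rs', rg', ρ'⟩ hc
  simp only [reveal_send h, Prod.mk.injEq, add_left_inj, add_right_inj] at hc
  obtain ⟨hk, rfl, rfl⟩ := hc
  refine Prod.ext rfl (Prod.ext rfl (funext fun j => ?_))
  exact share_injective _ b (congrFun hk j)

/-- Adding two residues wraps around exactly when the top bit of the second one is set and that of
the sum is not, provided that the top bit of the first one is not set. -/
theorem unmask {x : ℕ} (hx : x < 2 ^ (lf + 1)) (r : Word (lf + 2)) :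
    ((x : Word (lf + 2)) + r).val +
      2 ^ (lf + 2) * ((1 - ((x : Word (lf + 2)) + r).val >>> (lf + 1)) * (r.val >>> (lf + 1))) =
      x + r.val := by
  have hr := r.val_lt
  have hp : 2 ^ (lf + 2) = 2 * 2 ^ (lf + 1) := by ring
  have hpos : 0 < 2 ^ (lf + 1) := by positivity
  rw [ZMod.val_add, ZMod.val_natCast, Nat.mod_eq_of_lt (a := x) (by omega), Nat.shiftRight_eq_div_pow,
    Nat.shiftRight_eq_div_pow]
  generalize r.val = y at *
  rw [hp] at hr ⊢
  generalize 2 ^ (lf + 1) = P at *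
  have hdiv : ∀ z, z < 2 * P → z / P = if z < P then 0 else 1 := fun z hz => by
    split_ifs with h
    · exact Nat.div_eq_of_lt h
    · exact Nat.div_eq_of_lt_le (by omega) (by omega)
  rw [hdiv _ (Nat.mod_lt _ (by omega)), hdiv _ hr]
  -- If there is no wrap and y ≥ P, the sum has its top bit set and the correction vanishes. If
  -- there is a wrap, x < P forces y ≥ P and x + y - 2P < P, so the correction is exactly 2P.
  by_cases hw : x + y < 2 * P
  · rw [Nat.mod_eq_of_lt hw]
    split_ifs <;> omega
  · rw [Nat.mod_eq_sub_mod (by omega), Nat.mod_eq_of_lt (by omega)]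
    split_ifs <;> omega

/-- This is s = ŝ ⊕ r written as a polynomial that is affine in r, so that it can be evaluated on
shares. -/
theorem unmask_bit {s : Word l} (hs : s = 0 ∨ s = 1) (h : 1 ≤ l) (r : Word 1) :
    ((((s.val : Word 1) + r).val : ℕ) : Word l) +
      (1 - 2 * ((((s.val : Word 1) + r).val : ℕ) : Word l)) * (r.val : Word l) = s := by
  have : Fact (1 < 2 ^ l) := ⟨Nat.one_lt_two_pow (by omega)⟩
  have hr : r = 0 ∨ r = 1 := by revert r; decide
  have h0 : (0 : Word 1).val = 0 := rfl
  have h1 : (1 : Word 1).val = 1 := rfl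
  have h2 : ((1 : Word 1) + 1) = 0 := rfl
  rcases hs with rfl | rfl <;> rcases hr with rfl | rfl <;> simp [ZMod.val_one, h0, h1, h2]
  ring

/-- The shares of the two parties add up to the product. -/
theorem productShare_add (h : lf + 2 ≤ l) (s g : Fin 2 → Word l) (c : Coins l lf)
    (hs : s 0 + s 1 = 0 ∨ s 0 + s 1 = 1)
    (hg : ∃ z : ℤ, -2 ^ lf ≤ z ∧ z ≤ 2 ^ lf - 1 ∧ g 0 + g 1 = (z : Word l)) :
    productShare 0 (reveal (send lf (s 0) (g 0) (key c 0)) (send lf (s 1) (g 1) (key c 1)))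
        (key c 0) +
      productShare 1 (reveal (send lf (s 0) (g 0) (key c 0)) (send lf (s 1) (g 1) (key c 1)))
        (key c 1) = (s 0 + s 1) * (g 0 + g 1) := by
  rw [reveal_send h]
  obtain ⟨rs, rg, ρ⟩ := c
  obtain ⟨z, hz0, hz1, hz⟩ := hg
  have h2 : 2 ^ (lf + 2) ∣ 2 ^ l := pow_dvd_pow 2 h
  -- The bias 2^lf makes the gradient a natural number below 2^(lf + 1), as `unmask` requires.
  obtain ⟨x, hx⟩ : ∃ x : ℕ, (x : ℤ) = z + 2 ^ lf := ⟨(z + 2 ^ lf).toNat, by omega⟩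
  have hxlt : x < 2 ^ (lf + 1) := by zify; rw [pow_succ]; omega
  have hxw : ((g 0 + g 1).val : Word (lf + 2)) + rg + 2 ^ lf = (x : Word (lf + 2)) + rg := by
    rw [cast_val h2, hz, map_intCast]
    have := congrArg (Int.cast : ℤ → Word (lf + 2)) hx
    push_cast at this
    rw [this]; ring
  have hgx : g 0 + g 1 = (x : Word l) - 2 ^ lf := by
    have := congrArg (Int.cast : ℤ → Word l) hx
    push_cast at this
    rw [this, hz]; ring
  have e1 := unmask_bit hs (by omega) rs
  have e2 := congrArg (Nat.cast : ℕ → Word l) (unmask hxlt rg)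
  -- Eliminates the key of `P_0` in favour of the dealt values and the key of `P_1`, whose
  -- contributions then cancel.
  have k := fun j => eq_sub_of_add_eq (key_add (l := l) (rs, rg, ρ) j)
  simp only [k, hxw, productShare, dealt]
  push_cast at e2 ⊢
  generalize ((((s 0 + s 1).val : Word 1) + rs).val : Word l) = sh at *
  generalize (((x : Word (lf + 2)) + rg).val : Word l) = gh at *
  generalize ((1 - ((x : Word (lf + 2)) + rg).val >>> (lf + 1) : ℕ) : Word l) = vg at *
  rw [hgx, ← e1, eq_sub_of_add_eq e2.symm]
  simp only [Fin.val_zero, Fin.val_one]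
  push_cast
  ring

/-! ### Encoding keys and opened values by one number -/

/-- In mixed radix, a block of a natural number consists of five `l`-bit digits, a bit and an
`(lf + 2)`-bit digit. This is what remains when the digits of the lowest block are removed. -/
def dropBlock (l lf X : ℕ) : ℕ :=
  X / 2 ^ l / 2 ^ l / 2 ^ l / 2 ^ l / 2 ^ l / 2 / 2 ^ (lf + 2)

/-- The number of bits of a block. -/
def blockBits (l lf : ℕ) : ℕ := 5 * l + lf + 3

/-- The opened values in the lowest block. -/
def blockOpened (l lf X : ℕ) : Masked lf :=
  (((X / 2 ^ l / 2 ^ l / 2 ^ l / 2 ^ l / 2 ^ l : ℕ) : Word 1),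
    ((X / 2 ^ l / 2 ^ l / 2 ^ l / 2 ^ l / 2 ^ l / 2 : ℕ) : Word (lf + 2)))

/-- The sign by which the shares of `r_s`, `u` and `m` are multiplied. -/
def sign (l : ℕ) (o : Masked lf) : Word l := 1 - 2 * (o.1.val : Word l)

/-- The key in the lowest block, apart from the share of `u`. -/
def blockMasks (l X : ℕ) : Key l :=
  ![((X / 2 ^ l : ℕ) : Word l), ((X / 2 ^ l / 2 ^ l : ℕ) : Word l), 0,
    ((X / 2 ^ l / 2 ^ l / 2 ^ l : ℕ) : Word l),
    ((X / 2 ^ l / 2 ^ l / 2 ^ l / 2 ^ l : ℕ) : Word l)]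

/-- The share of `u` for which the share of the product is the difference of the lowest digits of
this block and of the next one. -/
def blockU (l lf X : ℕ) (b : Fin 2) : Word l :=
  sign l (blockOpened l lf X) *
    (productShare b (blockOpened l lf X) (blockMasks l X) - X + (dropBlock l lf X : ℕ))

/-- The key in the lowest block. -/
def blockKey (l lf X : ℕ) (b : Fin 2) : Key l :=
  Function.update (blockMasks l X) 2 (blockU l lf X b)

/-- The sign is ±1, hence its own inverse; this is what makes the equation for the share of u
solvable modulo 2^l. -/
theorem sign_mul_self (l : ℕ) (o : Masked lf) : sign l o * sign l o = 1 := by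
  have h : o.1 = 0 ∨ o.1 = 1 := by generalize o.1 = x; revert x; decide
  have h1 : (1 : Word 1).val = 1 := rfl
  rcases h with h | h <;> simp [sign, h, h1]
  ring

theorem productShare_update (b : Fin 2) (o : Masked lf) (k : Key l) (a : Word l) :
    productShare b o (Function.update k 2 a) =
      productShare b o (Function.update k 2 0) - sign l o * a := by
  simp [productShare, sign]
  ring

theorem productShare_blockKey (l lf X : ℕ) (b : Fin 2) :
    productShare b (blockOpened l lf X) (blockKey l lf X b) =
      (X : Word l) - (dropBlock l lf X : ℕ) := by
  have : Function.update (blockMasks l X) 2 0 = blockMasks l X :=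
    Function.update_eq_self_iff.2 rfl
  rw [blockKey, productShare_update, this, blockU, ← mul_assoc, sign_mul_self]
  ring

/-- The sum telescopes, and the last term is zero because no digits are left after `n` blocks. -/
theorem sum_productShare_block (l lf X : ℕ) (b : Fin 2) (n : ℕ)
    (h : (dropBlock l lf)^[n] X = 0) :
    ∑ i : Fin n, productShare b (blockOpened l lf ((dropBlock l lf)^[i] X))
      (blockKey l lf ((dropBlock l lf)^[i] X) b) = (X : Word l) := by
  simp only [productShare_blockKey, ← Function.iterate_succ_apply' (dropBlock l lf)]
  rw [Fin.sum_univ_eq_sum_range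
    fun i => (((dropBlock l lf)^[i] X : ℕ) : Word l) - ((dropBlock l lf)^[i + 1] X : ℕ),
    Finset.sum_range_sub', h]
  simp

theorem eq_of_div_eq {d x y : ℕ} (h : (x : ZMod d) = y) (h' : x / d = y / d) : x = y := by
  rw [← Nat.div_add_mod x d, ← Nat.div_add_mod y d, h', (ZMod.natCast_eq_natCast_iff' x y d).1 h]

/-- The lowest block and the rest determine a number. -/
theorem block_injective {X Y : ℕ} {b : Fin 2}
    (ho : blockOpened l lf X = blockOpened l lf Y) (hk : blockKey l lf X b = blockKey l lf Y b)
    (hd : dropBlock l lf X = dropBlock l lf Y) : X = Y := by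
  have h := productShare_blockKey l lf X b
  rw [ho, hk, productShare_blockKey, hd, sub_left_inj] at h
  have k (j : Fin 5) (hj : j ≠ 2) : blockMasks l X j = blockMasks l Y j := by
    simpa [blockKey, Function.update_apply, hj] using congrFun hk j
  -- The lowest digit is recovered from the product share and the next block. The other digits are
  -- read off directly, in the order in which division exposes them.
  refine eq_of_div_eq h.symm ?_
  refine eq_of_div_eq (k 0 (by decide)) ?_
  refine eq_of_div_eq (k 1 (by decide)) ?_
  refine eq_of_div_eq (k 3 (by decide)) ?_
  refine eq_of_div_eq (k 4 (by decide)) ?_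
  refine eq_of_div_eq (congrArg Prod.fst ho) ?_
  exact eq_of_div_eq (congrArg Prod.snd ho) hd

/-- Decoding runs from the last block downwards, since each lowest digit is recovered only relative
to the block after it. -/
theorem blocks_injective {b : Fin 2} (n : ℕ) : ∀ {X Y : ℕ},
    (∀ i < n, blockOpened l lf ((dropBlock l lf)^[i] X) =
      blockOpened l lf ((dropBlock l lf)^[i] Y)) →
    (∀ i < n, blockKey l lf ((dropBlock l lf)^[i] X) b =
      blockKey l lf ((dropBlock l lf)^[i] Y) b) →
    (dropBlock l lf)^[n] X = (dropBlock l lf)^[n] Y → X = Y := by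
  induction n with
  | zero => exact fun _ _ h => h
  | succ n ih =>
    intro X Y ho hk hd
    exact block_injective (ho 0 (by omega)) (hk 0 (by omega)) <| ih
      (fun i hi => ho (i + 1) (by omega)) (fun i hi => hk (i + 1) (by omega)) hd

theorem dropBlock_eq (l lf X : ℕ) : dropBlock l lf X = X / 2 ^ blockBits l lf := by
  simp only [dropBlock, Nat.div_div_eq_div_mul, blockBits]
  congr 1
  ring

theorem dropBlock_iterate_eq_zero (n : ℕ) : ∀ {X : ℕ}, X < 2 ^ (n * blockBits l lf) →
    (dropBlock l lf)^[n] X = 0 := by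
  induction n with
  | zero => intro X h; simpa using h
  | succ n ih =>
    intro X h
    refine ih ?_
    rw [dropBlock_eq]
    exact Nat.div_lt_of_lt_mul (h.trans_eq (by ring))

/-- The number of bits that the simulator draws. -/
def drawBits (l lf n : ℕ) : ℕ := n * blockBits l lf - l

/-- The number with lowest digit `y`, and with the other digits given by `r`. -/
def seed (l y r : ℕ) : ℕ := r * 2 ^ l + y

variable {N : ℕ}

/-- With at least one block the subtraction in `drawBits` is not truncated: the drawn bits and the l
bits of y fill all blocks exactly. -/
theorem l_add_drawBits (l lf : ℕ) (hN : 0 < N) : l + drawBits l lf N = N * blockBits l lf := by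
  have : l ≤ blockBits l lf := by rw [blockBits]; omega
  have := Nat.le_mul_of_pos_left (blockBits l lf) hN
  rw [drawBits]; omega

theorem seed_lt (hN : 0 < N) (y : Word l) (r : Fin (2 ^ drawBits l lf N)) :
    seed l y.val r < 2 ^ (N * blockBits l lf) := by
  rw [← l_add_drawBits l lf hN, pow_add, seed]
  calc r * 2 ^ l + y.val < r * 2 ^ l + 2 ^ l := Nat.add_lt_add_left y.val_lt _
    _ = 2 ^ l * (r + 1) := by ring
    _ ≤ _ := Nat.mul_le_mul_left _ r.2

/-- The keys and the opened values read off from the blocks of a number. -/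
def blocks (l lf N : ℕ) (b : Fin 2) (X : ℕ) : (Fin N → Key l) × (Fin N → Masked lf) :=
  (fun i => blockKey l lf ((dropBlock l lf)^[i] X) b,
    fun i => blockOpened l lf ((dropBlock l lf)^[i] X))

/-- Injectivity is the decoding of blocks, started from the common remainder 0. Both sides have 2^(N
· `blockBits`) elements, so surjectivity is free. -/
theorem bijective_blocks_seed (hN : 0 < N) (b : Fin 2) :
    Function.Bijective fun q : Word l × Fin (2 ^ drawBits l lf N) =>
      blocks l lf N b (seed l q.1.val q.2) := by
  rw [Fintype.bijective_iff_injective_and_card]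
  constructor
  · rintro ⟨y, r⟩ ⟨y', r'⟩ h
    have hX : seed l y.val r = seed l y'.val r' :=
      blocks_injective N (fun i hi => congrFun (congrArg Prod.snd h) ⟨i, hi⟩)
        (fun i hi => congrFun (congrArg Prod.fst h) ⟨i, hi⟩)
        (by rw [dropBlock_iterate_eq_zero N (seed_lt hN y r),
          dropBlock_iterate_eq_zero N (seed_lt hN y' r')])
    have hy : y.val = y'.val := by
      have := congrArg (· % 2 ^ l) hX
      simpa only [seed, Nat.mul_add_mod_self_right, Nat.mod_eq_of_lt y.val_lt,
        Nat.mod_eq_of_lt y'.val_lt] using this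
    refine Prod.ext (ZMod.val_injective _ hy) (Fin.ext ?_)
    rw [seed, seed, hy] at hX
    exact Nat.eq_of_mul_eq_mul_right (by positivity) (Nat.add_right_cancel hX)
  · simp only [Fintype.card_prod, ZMod.card, Fintype.card_fin, Fintype.card_fun]
    rw [← pow_add, l_add_drawBits l lf hN, blockBits, mul_comm N, pow_mul,
      ← mul_pow]
    ring

theorem sum_productShare_blocks (hN : 0 < N) (b : Fin 2) (y : Word l)
    (r : Fin (2 ^ drawBits l lf N)) :
    ∑ i, productShare b ((blocks l lf N b (seed l y.val r)).2 i)
      ((blocks l lf N b (seed l y.val r)).1 i) = y := by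
  refine (sum_productShare_block l lf _ b N
    (dropBlock_iterate_eq_zero N (seed_lt hN y r))).trans ?_
  simp [seed]

/-! ### The execution as a function of a uniform tuple -/

/-- The message that the other party has sent, when the values `o` are opened. -/
def peer {lf : ℕ} (o x : Masked lf) : Masked lf := (o.1 - x.1, o.2 - x.2 - 2 ^ lf)

theorem peer_reveal (x : Fin 2 → Masked lf) (b : Fin 2) :
    peer (reveal (x 0) (x 1)) (x b) = x (1 - b) := by
  fin_cases b <;> ext <;> simp [peer, reveal] <;> ring

namespace Instance

variable (I : Instance)

theorem bijective_key_opened (b : Fin 2) : Function.Bijective fun c =>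
    ((fun i => key (c i) b, I.opened c) : (Fin I.N → Key I.l) × (Fin I.N → Masked I.lf)) := by
  rw [Fintype.bijective_iff_injective_and_card]
  constructor
  · intro c c' h
    funext i
    exact key_reveal_injective I.lf_le (fun b => I.s b i) (fun b => I.g b i) b
      (Prod.ext (congrFun (congrArg Prod.fst h) i) (congrFun (congrArg Prod.snd h) i))
  · simp only [Fintype.card_prod, ZMod.card, Fintype.card_fun, Fintype.card_fin, ← mul_pow]
    ring

theorem map_coins (b : Fin 2) :
    (I.coins.map fun c => ((fun i => key (c i) b), I.opened c)) =
      PMF.uniformOfFintype ((Fin I.N → Key I.l) × (Fin I.N → Masked I.lf)) :=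
  PMF.map_uniformOfFintype_of_bijective (I.bijective_key_opened b)

/-- The part of the view for one index, as determined by the key and the opened values. -/
def entry (b : Fin 2) (i : Fin I.N) (k : Key I.l) (o : Masked I.lf) : List ℕ :=
  List.ofFn (fun j => (k j).val) ++
    [(peer o (send I.lf (I.s b i) (I.g b i) k)).1.val,
      (peer o (send I.lf (I.s b i) (I.g b i) k)).2.val]

/-- The view as determined by the keys and the opened values. -/
def viewOf (b : Fin 2) (q : (Fin I.N → Key I.l) × (Fin I.N → Masked I.lf)) : List ℕ :=
  I.input b ++ (List.finRange I.N).flatMap fun i => I.entry b i (q.1 i) (q.2 i)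

/-- The output as determined by the keys and the opened values. -/
def resultOf (b : Fin 2) (q : (Fin I.N → Key I.l) × (Fin I.N → Masked I.lf)) : Word I.l :=
  ∑ i, productShare b (q.2 i) (q.1 i)

/-- The sum which the protocol computes. -/
def total : Word I.l := ∑ i, (I.s 0 i + I.s 1 i) * (I.g 0 i + I.g 1 i)

/-- The sharing of the sum in which the share of `P_b` is `y`. -/
def sharing (b : Fin 2) (y : Word I.l) : Fin 2 → Word I.l :=
  share I.total (if b = 0 then I.total - y else y)

theorem sharing_apply (b : Fin 2) (y : Word I.l) : I.sharing b y b = y := by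
  fin_cases b <;> simp [sharing, share]

/-- ρ ↦ `I.total - ρ` preserves the uniform law, so either share may be taken as the uniform one. -/
theorem ideal_eq (b : Fin 2) :
    I.ideal = (PMF.uniformOfFintype (Word I.l)).map (I.sharing b) := by
  have h : Function.Bijective fun y => if b = 0 then I.total - y else y := by
    fin_cases b
    · exact (Equiv.subLeft I.total).bijective
    · exact Function.bijective_id
  exact (congrArg (PMF.map _) (PMF.map_uniformOfFintype_of_bijective h).symm).trans
    (PMF.map_comp _ _ _)

theorem view_eq (c : Fin I.N → Coins I.l I.lf) (b : Fin 2) :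
    I.view c b = I.viewOf b (fun i => key (c i) b, I.opened c) := by
  rw [view, viewOf]
  congr 2
  funext i
  rw [← peer_reveal (fun b => I.message c b i) b]
  rfl

theorem result_add (c : Fin I.N → Coins I.l I.lf) :
    I.result c 0 + I.result c 1 = I.total := by
  rw [result, result, ← Finset.sum_add_distrib, total]
  exact Finset.sum_congr rfl fun i _ => productShare_add I.lf_le (fun b => I.s b i)
    (fun b => I.g b i) (c i) (I.s_bit i) (I.g_range i)

/-- By correctness, the output of one party fixes the output of the other. -/
theorem result_eq (c : Fin I.N → Coins I.l I.lf) (b : Fin 2) :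
    I.result c = I.sharing b (I.resultOf b (fun i => key (c i) b, I.opened c)) := by
  have h : I.resultOf b (fun i => key (c i) b, I.opened c) = I.result c b := rfl
  have ha := I.result_add c
  rw [h]
  funext b'
  fin_cases b <;> fin_cases b' <;> simp [sharing, share, ← ha]

theorem exec_eq (b : Fin 2) :
    (I.exec.map fun e => (e.1 b, e.2)) =
      (PMF.uniformOfFintype ((Fin I.N → Key I.l) × (Fin I.N → Masked I.lf))).map fun q =>
        (I.viewOf b q, I.sharing b (I.resultOf b q)) := by
  rw [← I.map_coins b, exec, PMF.map_comp, PMF.map_comp]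
  refine congrArg (PMF.map · _) (funext fun c => ?_)
  simp only [Function.comp_apply, view_eq, ← result_eq]

/-- A program which draws enough bits and outputs the view described by them is a simulator. -/
theorem simulation (b : Fin 2) (μ : Word I.l → PMF (List ℕ))
    (h : ∀ y, μ y = (PMF.uniformOfFintype (Fin (2 ^ drawBits I.l I.lf I.N))).map
      fun r : Fin _ => I.viewOf b (blocks I.l I.lf I.N b (seed I.l y.val r))) :
    (I.ideal.bind fun y => (μ (y b)).map fun view => (view, y)) =
      I.exec.map fun e => (e.1 b, e.2) := by
  -- The uniform tuple on the real side is replaced by its encoding through (y, r), whose output is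
  -- y by telescoping.
  rw [exec_eq, ideal_eq I b, PMF.bind_map,
    ← PMF.map_uniformOfFintype_of_bijective (bijective_blocks_seed (l := I.l) (lf := I.lf) I.N_pos b),
    PMF.map_comp]
  simp only [Function.comp_def, sharing_apply, h, PMF.map_comp]
  rw [PMF.bind_map_uniformOfFintype]
  refine congrArg (PMF.map · _) (funext fun q => ?_)
  rw [resultOf, sum_productShare_blocks I.N_pos]

end Instance

/-! ### The simulator -/

namespace Simulator

open Ram

/-- The state of the simulator between the commands. The registers hold the last coin, the number
from which the blocks are read, `2 ^ l`, `2 ^ lf` and a counter. -/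
def state (input out : List ℕ) (c X M F i : ℕ) : State where
  reg
    | 0 => c
    | 1 => X
    | 2 => M
    | 3 => F
    | 4 => i
    | _ => 0
  mem := fun _ => 0
  inp := input
  out := out
  time := 0

variable (input out : List ℕ) (c X M F i a : ℕ)

theorem update_reg_one : ({ state input out c X M F i with
    reg := Function.update (state input out c X M F i).reg 1 a } : State) =
      state input out c a M F i := by
  simp only [state, State.mk.injEq, and_true]
  funext x
  rcases x with _ | _ | _ | _ | _ | x <;> simp

theorem update_reg_two : ({ state input out c X M F i with
    reg := Function.update (state input out c X M F i).reg 2 a } : State) =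
      state input out c X a F i := by
  simp only [state, State.mk.injEq, and_true]
  funext x
  rcases x with _ | _ | _ | _ | _ | x <;> simp

theorem update_reg_three : ({ state input out c X M F i with
    reg := Function.update (state input out c X M F i).reg 3 a } : State) =
      state input out c X M a i := by
  simp only [state, State.mk.injEq, and_true]
  funext x
  rcases x with _ | _ | _ | _ | _ | x <;> simp

theorem update_reg_four : ({ state input out c X M F i with
    reg := Function.update (state input out c X M F i).reg 4 a } : State) =
      state input out c X M F a := by
  simp only [state, State.mk.injEq, and_true]
  funext x
  rcases x with _ | _ | _ | _ | _ | x <;> simp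

theorem set₂_state (r d : ℕ) : (state input out c X M F i).set₂ 1 0 r d =
    state input out d r M F i := by
  simp only [state, State.set₂, State.mk.injEq, and_true]
  funext x
  rcases x with _ | _ | _ | _ | _ | x <;> simp

variable {input c X M F i} in
theorem sizeLE_state {K : ℕ} (hinp : ∀ a ∈ input, Nat.size a ≤ K) (hK : 1 ≤ K) (hc : c ≤ 1)
    (hX : Nat.size X ≤ K) (hM : Nat.size M ≤ K) (hF : Nat.size F ≤ K) (hi : i ≤ K) :
    (state input out c X M F i).SizeLE K where
  pos := hK
  reg x := by
    simp only [state]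
    split
    · exact (Nat.size_le_size hc).trans (by simpa using hK)
    · exact hX
    · exact hM
    · exact hF
    · exact (Nat.size_le.2 (Nat.lt_two_pow_self)).trans hi
    · simp
  mem x := by simp [state]
  inp x := by
    simp only [state, List.getD_eq_getElem?_getD]
    cases h : input[x]? with
    | none => simp
    | some y => exact hinp y (List.mem_of_getElem? h)

/-- The number without its `n` lowest digits. -/
def dropDigits : ℕ → Expr
  | 0 => .reg 1
  | n + 1 => .div (dropDigits n) (.reg 2)

/-- Minus one times the value of `e`, modulo the value of `m`. -/
def neg (m e : Expr) : Expr := .mul (.sub m (.lit 1)) e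

/-- The modulus `2 ^ (lf + 2)`. -/
def modulus : Expr := .mul (.lit 4) (.reg 3)

/-- The opened bit in the current block. -/
def bit : Expr := .mod (dropDigits 5) (.lit 2)

/-- The opened word in the current block. -/
def word : Expr := .mod (.div (dropDigits 5) (.lit 2)) modulus

/-- The number without its lowest block. -/
def nextBlock : Expr := .div (.div (dropDigits 5) (.lit 2)) modulus

/-- The negation of the top bit of the opened word. -/
def noCarry : Expr := .sub (.lit 1) (.div word (.mul (.lit 2) (.reg 3)))

/-- The sign `1 - 2 ŝ`, modulo `2 ^ l`. -/
def signExpr : Expr := .add (.lit 1) (neg (.reg 2) (.mul (.lit 2) bit))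

/-- The share of the product, apart from the summand with the share of `u`. -/
def productExpr (b : ℕ) : Expr :=
  .add (.mul (.lit b) (.mul bit word)) <|
  .add (.mul (.mul (.mul bit noCarry) (dropDigits 3)) modulus) <|
  .add (neg (.reg 2) (.mul bit (dropDigits 2))) <|
  .add (neg (.reg 2) (.mul (.lit b) (.mul bit (.reg 3)))) <|
  .add (.mul (.mul signExpr word) (dropDigits 1)) <|
  .add (.mul (.mul (.mul signExpr noCarry) (dropDigits 4)) modulus) <|
  neg (.reg 2) (.mul signExpr (.mul (dropDigits 1) (.reg 3)))

/-- The share of `u`, modulo `2 ^ l`. -/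
def uExpr (b : ℕ) : Expr :=
  .mul signExpr (.add (.add (productExpr b) (neg (.reg 2) (.reg 1))) nextBlock)

/-- The bit sent by the other party. -/
def bitMessage : Expr :=
  .mod (.add bit (.add (.inp (.add (.lit 3) (.reg 4))) (dropDigits 1))) (.lit 2)

/-- The word sent by the other party. -/
def wordMessage : Expr :=
  .mod (.add word (neg modulus (.add (.add
    (.inp (.add (.add (.lit 3) (.inp (.lit 2))) (.reg 4))) (dropDigits 2)) (.reg 3)))) modulus

/-- Outputs the part of the view for one index, and passes to the next block. -/
def body (b : ℕ) : Prog :=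
  .seq (.emit (.mod (dropDigits 1) (.reg 2))) <|
  .seq (.emit (.mod (dropDigits 2) (.reg 2))) <|
  .seq (.emit (.mod (uExpr b) (.reg 2))) <|
  .seq (.emit (.mod (dropDigits 3) (.reg 2))) <|
  .seq (.emit (.mod (dropDigits 4) (.reg 2))) <|
  .seq (.emit bitMessage) <|
  .seq (.emit wordMessage) <|
  .seq (.assign 1 nextBlock) (.assign 4 (.add (.reg 4) (.lit 1)))

/-- Outputs the input of the party. -/
def echo : Prog :=
  .loop (.add (.lit 3) (.mul (.lit 2) (.inp (.lit 2))))
    (.seq (.emit (.inp (.reg 4))) (.assign 4 (.add (.reg 4) (.lit 1))))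

/-- The number of bits to be drawn. -/
def drawExpr : Expr :=
  .sub (.mul (.inp (.lit 2))
    (.add (.add (.mul (.lit 5) (.inp (.lit 0))) (.inp (.lit 1))) (.lit 3))) (.inp (.lit 0))

/-- The simulator. -/
def simulator (b : ℕ) : Prog :=
  .seq (.pow 2 (.inp (.lit 0))) <|
  .seq (.pow 3 (.inp (.lit 1))) <|
  .seq echo <|
  .seq (.assign 4 (.lit 0)) <|
  .seq (.draw 1 0 drawExpr) <|
  .seq (.assign 1 (.add (.mul (.reg 1) (.reg 2))
    (.inp (.add (.lit 3) (.mul (.lit 2) (.inp (.lit 2))))))) <|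
  .loop (.inp (.lit 2)) (body b)

/-! ### Values of the simulator's expressions -/

section

variable {l lf : ℕ}

theorem cast_pred_two_pow (n : ℕ) : ((2 ^ n - 1 : ℕ) : Word n) = -1 := by
  have h : ((2 ^ n : ℕ) : Word n) = 0 := ZMod.natCast_self _
  rw [Nat.cast_sub Nat.one_le_two_pow, h]
  simp

theorem eval_bit : bit.eval (state input out c X (2 ^ l) F i) = (blockOpened l lf X).1.val := by
  rw [blockOpened, ZMod.val_natCast]
  rfl

theorem eval_modulus : modulus.eval (state input out c X M (2 ^ lf) i) = 2 ^ (lf + 2) := by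
  rw [pow_add, mul_comm]
  rfl

theorem eval_word : word.eval (state input out c X (2 ^ l) (2 ^ lf) i) =
    (blockOpened l lf X).2.val := by
  rw [blockOpened, ZMod.val_natCast, ← eval_modulus input out c X (2 ^ l) i]
  rfl

theorem eval_nextBlock : nextBlock.eval (state input out c X (2 ^ l) (2 ^ lf) i) =
    dropBlock l lf X := by
  rw [dropBlock, ← eval_modulus input out c X (2 ^ l) i]
  rfl

theorem eval_noCarry : noCarry.eval (state input out c X (2 ^ l) (2 ^ lf) i) =
    1 - (blockOpened l lf X).2.val >>> (lf + 1) := by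
  rw [← eval_word input out c X i, Nat.shiftRight_eq_div_pow, pow_succ']
  rfl

/-- Multiplying by 2^l - 1 negates modulo 2^l and avoids truncated subtraction on natural numbers.
-/
theorem cast_eval_neg (e : Expr) :
    (((neg (.reg 2) e).eval (state input out c X (2 ^ l) F i) : ℕ) : Word l) =
      -(e.eval (state input out c X (2 ^ l) F i) : ℕ) := by
  have : (neg (.reg 2) e).eval (state input out c X (2 ^ l) F i) =
    (2 ^ l - 1) * e.eval (state input out c X (2 ^ l) F i) := rfl
  rw [this, Nat.cast_mul, cast_pred_two_pow, neg_one_mul]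

theorem cast_eval_signExpr :
    ((signExpr.eval (state input out c X (2 ^ l) F i) : ℕ) : Word l) =
      sign l (blockOpened l lf X) := by
  rw [signExpr, Expr.eval, Nat.cast_add, cast_eval_neg]
  have hb := eval_bit input out c X F i (l := l) (lf := lf)
  simp only [Expr.eval, hb, sign]
  push_cast
  ring

theorem cast_eval_uExpr (b : Fin 2) :
    (((uExpr b.val).eval (state input out c X (2 ^ l) (2 ^ lf) i) : ℕ) : Word l) =
      blockU l lf X b := by
  have h0 : (Expr.reg 1).eval (state input out c X (2 ^ l) (2 ^ lf) i) = X := rfl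
  have hF : (Expr.reg 3).eval (state input out c X (2 ^ l) (2 ^ lf) i) = 2 ^ lf := rfl
  have h1 : (dropDigits 1).eval (state input out c X (2 ^ l) (2 ^ lf) i) = X / 2 ^ l := rfl
  have h2 : (dropDigits 2).eval (state input out c X (2 ^ l) (2 ^ lf) i) =
    X / 2 ^ l / 2 ^ l := rfl
  have h3 : (dropDigits 3).eval (state input out c X (2 ^ l) (2 ^ lf) i) =
    X / 2 ^ l / 2 ^ l / 2 ^ l := rfl
  have h4 : (dropDigits 4).eval (state input out c X (2 ^ l) (2 ^ lf) i) =
    X / 2 ^ l / 2 ^ l / 2 ^ l / 2 ^ l := rfl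
  have hadd (e e' : Expr) (s : State) : (Expr.add e e').eval s = e.eval s + e'.eval s := rfl
  have hmul (e e' : Expr) (s : State) : (Expr.mul e e').eval s = e.eval s * e'.eval s := rfl
  have hlit (n : ℕ) (s : State) : (Expr.lit n).eval s = n := rfl
  have hb := eval_bit input out c X (2 ^ lf) i (l := l) (lf := lf)
  have hs := cast_eval_signExpr input out c X (2 ^ lf) i (l := l) (lf := lf)
  simp only [uExpr, productExpr, hadd, hmul, Nat.cast_add, Nat.cast_mul, cast_eval_neg,
    hs, hb, eval_word, eval_nextBlock, eval_noCarry,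
    eval_modulus, h0, h1, h2, h3, h4, hF, hlit, blockU, productShare, blockMasks]
  simp only [Matrix.cons_val]
  rw [← sign]
  push_cast
  ring

end

/-! ### Execution and running time of the simulator -/

section

variable (I : Instance) (b : Fin 2) (y : Word I.l)

/-- Bounds the size of all numbers that occur and the number of iterations of all loops. -/
def bound : ℕ := 4 * I.size + 10

theorem blockBits_lt_bound : I.N * blockBits I.l I.lf < bound I := by
  -- Since lf + 2 ≤ l, a block has at most 6l + 1 ≤ 8l bits; the factor 4 in `bound` is 8 over the 2
  -- in `size`.
  have h1 : I.N * (5 * I.l + I.lf + 3) ≤ I.N * (8 * I.l) :=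
    Nat.mul_le_mul_left _ (by have := I.lf_le; omega)
  rw [bound, Instance.size, blockBits]
  linarith

theorem l_add_two_le_bound : I.l + 2 ≤ bound I := by
  have := Nat.le_mul_of_pos_left I.l I.N_pos
  rw [bound, Instance.size, mul_assoc]
  omega

theorem N_le_bound : 3 + 2 * I.N ≤ bound I := by
  have := Nat.le_mul_of_pos_right I.N (show 0 < I.l by have := I.lf_le; omega)
  rw [bound, Instance.size, mul_assoc]
  omega

theorem drawBits_lt_bound : drawBits I.l I.lf I.N < bound I :=
  (Nat.sub_le _ _).trans_lt (blockBits_lt_bound I)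

theorem length_input : (I.input b).length = 3 + 2 * I.N := by
  simp [Instance.input]
  omega

theorem size_le_bound : ∀ a ∈ I.input b ++ [y.val], Nat.size a ≤ bound I := by
  have hl := l_add_two_le_bound I
  have hN := N_le_bound I
  have hlf := I.lf_le
  have hlt (a : ℕ) (ha : a ≤ bound I) : Nat.size a ≤ bound I :=
    (Nat.size_le.2 Nat.lt_two_pow_self).trans ha
  have hw (w : Word I.l) : Nat.size w.val ≤ bound I :=
    (Nat.size_le.2 w.val_lt).trans (by omega)
  intro a ha
  simp only [Instance.input, List.mem_append, List.mem_cons, List.not_mem_nil, or_false,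
    List.mem_ofFn] at ha
  obtain (((rfl | rfl | rfl) | ⟨i, rfl⟩) | ⟨i, rfl⟩) | rfl := ha
  exacts [hlt _ (by omega), hlt _ (by omega), hlt _ (by omega), hw _, hw _, hw _]

theorem getD_input_s (i : Fin I.N) :
    (I.input b ++ [y.val]).getD (3 + i) 0 = (I.s b i).val := by
  have : 3 + i.val = i + 3 := add_comm _ _
  simp [Instance.input, this, List.getElem?_append]

theorem getD_input_g (i : Fin I.N) :
    (I.input b ++ [y.val]).getD (3 + I.N + i) 0 = (I.g b i).val := by
  have : 3 + I.N + i.val = I.N + i + 3 := by omega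
  simp [Instance.input, this]

theorem getD_input_last : (I.input b ++ [y.val]).getD (3 + 2 * I.N) 0 = y.val := by
  rw [← length_input I b]
  simp

theorem eval_bitMessage (out : List ℕ) (c X F : ℕ) (i : Fin I.N) :
    bitMessage.eval (state (I.input b ++ [y.val]) out c X (2 ^ I.l) F i) =
      (peer (blockOpened I.l I.lf X)
        (send I.lf (I.s b i) (I.g b i) (blockKey I.l I.lf X b))).1.val := by
  have hb := eval_bit (I.input b ++ [y.val]) out c X F i (l := I.l) (lf := I.lf)
  have h1 : 2 ^ 1 ∣ 2 ^ I.l := two_dvd_two_pow I.lf_le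
  have h : bitMessage.eval (state (I.input b ++ [y.val]) out c X (2 ^ I.l) F i) =
      (bit.eval (state (I.input b ++ [y.val]) out c X (2 ^ I.l) F i) +
        ((I.input b ++ [y.val]).getD (3 + i) 0 + X / 2 ^ I.l)) % 2 ^ 1 := rfl
  -- Modulo 2 the program may add where `peer` subtracts.
  have hneg : ∀ x : Word 1, -x = x := by decide
  have hk : ((blockKey I.l I.lf X b 0).val : Word 1) = (X / 2 ^ I.l : ℕ) :=
    (cast_val h1 _).trans (map_natCast _ _)
  rw [h, hb, getD_input_s, ← ZMod.val_natCast, peer, sub_eq_add_neg, hneg, send, hk]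
  simp only [Nat.cast_add, ZMod.natCast_zmod_val]

theorem eval_wordMessage (out : List ℕ) (c X : ℕ) (i : Fin I.N) :
    wordMessage.eval (state (I.input b ++ [y.val]) out c X (2 ^ I.l) (2 ^ I.lf) i) =
      (peer (blockOpened I.l I.lf X)
        (send I.lf (I.s b i) (I.g b i) (blockKey I.l I.lf X b))).2.val := by
  have hw := eval_word (I.input b ++ [y.val]) out c X i (l := I.l) (lf := I.lf)
  have hm := eval_modulus (I.input b ++ [y.val]) out c X (2 ^ I.l) i (lf := I.lf)
  have h2 : 2 ^ (I.lf + 2) ∣ 2 ^ I.l := pow_dvd_pow 2 I.lf_le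
  set s := state (I.input b ++ [y.val]) out c X (2 ^ I.l) (2 ^ I.lf) i
  have h : wordMessage.eval s = (word.eval s + (modulus.eval s - 1) *
      ((I.input b ++ [y.val]).getD (3 + I.N + i) 0 + X / 2 ^ I.l / 2 ^ I.l + 2 ^ I.lf)) %
        modulus.eval s := rfl
  -- The program uses the quotient without reducing it modulo 2^l; this is harmless because the
  -- smaller modulus divides 2^l.
  have hk : ((I.g b i + blockKey I.l I.lf X b 1).val : Word (I.lf + 2)) =
      ((I.g b i).val : Word (I.lf + 2)) + (X / 2 ^ I.l / 2 ^ I.l : ℕ) := by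
    rw [cast_val h2, cast_val h2, map_add]
    exact congrArg _ (map_natCast _ _)
  rw [h, hw, hm, getD_input_g, ← ZMod.val_natCast, peer, send, hk]
  congr 1
  rw [Nat.cast_add, Nat.cast_mul, cast_pred_two_pow, ZMod.natCast_zmod_val]
  push_cast
  ring

theorem leads_body (out : List ℕ) {c X : ℕ} (hc : c ≤ 1) (hX : Nat.size X ≤ bound I)
    (i : Fin I.N) :
    Leads (body b) ((body b).weight * bound I)
      (state (I.input b ++ [y.val]) out c X (2 ^ I.l) (2 ^ I.lf) i)
      (state (I.input b ++ [y.val])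
        (out ++ I.entry b i (blockKey I.l I.lf X b) (blockOpened I.l I.lf X)) c
        (dropBlock I.l I.lf X) (2 ^ I.l) (2 ^ I.lf) (i + 1)) := by
  have hl := l_add_two_le_bound I
  have hN := N_le_bound I
  have hlf := I.lf_le
  have hs (out : List ℕ) {X : ℕ} (hX : Nat.size X ≤ bound I) :
      (state (I.input b ++ [y.val]) out c X (2 ^ I.l) (2 ^ I.lf) i).SizeLE (bound I) :=
    sizeLE_state out (size_le_bound I b y) (by omega) hc hX
      (Nat.size_pow.trans_le (by omega)) (Nat.size_pow.trans_le (by omega)) (by omega)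
  have hd : Nat.size (dropBlock I.l I.lf X) ≤ bound I :=
    (Nat.size_le_size (by rw [dropBlock_eq]; exact Nat.div_le_self _ _)).trans hX
  have hu := cast_eval_uExpr (I.input b ++ [y.val]) (l := I.l) (lf := I.lf) (c := c) (X := X)
    (i := i) (b := b)
  have hn := eval_nextBlock (I.input b ++ [y.val]) (l := I.l) (lf := I.lf) (c := c) (X := X)
    (i := i)
  have emit (e : Expr) (a : ℕ) (out : List ℕ)
      (h : e.eval (state (I.input b ++ [y.val]) out c X (2 ^ I.l) (2 ^ I.lf) i) = a) :
      Leads (.emit e) ((Prog.emit e).weight * bound I)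
        (state (I.input b ++ [y.val]) out c X (2 ^ I.l) (2 ^ I.lf) i)
        (state (I.input b ++ [y.val]) (out ++ [a]) c X (2 ^ I.l) (2 ^ I.lf) i) :=
    leads_emit_weight (hs out hX) (h ▸ rfl)
  have emit_mod (e : Expr) (w : Word I.l) (out : List ℕ)
      (h : (e.eval (state (I.input b ++ [y.val]) out c X (2 ^ I.l) (2 ^ I.lf) i) : Word I.l) = w) :=
    emit (.mod e (.reg 2)) w.val out (by rw [← h, ZMod.val_natCast]; rfl)
  rw [body]
  refine .seq_weight (emit_mod _ (blockKey I.l I.lf X b 0) _ rfl) ?_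
  refine .seq_weight (emit_mod _ (blockKey I.l I.lf X b 1) _ rfl) ?_
  refine .seq_weight (emit_mod _ (blockKey I.l I.lf X b 2) _ (hu _)) ?_
  refine .seq_weight (emit_mod _ (blockKey I.l I.lf X b 3) _ rfl) ?_
  refine .seq_weight (emit_mod _ (blockKey I.l I.lf X b 4) _ rfl) ?_
  refine .seq_weight (emit _ _ _ (eval_bitMessage I b y _ c X _ i)) ?_
  refine .seq_weight (emit _ _ _ (eval_wordMessage I b y _ c X i)) ?_
  refine .seq_weight (leads_assign_weight (hs _ hX) (update_reg_one _ _ _ _ _ _ _ _)) ?_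
  rw [hn]
  have he : I.entry b i (blockKey I.l I.lf X b) (blockOpened I.l I.lf X) =
      [(blockKey I.l I.lf X b 0).val] ++ [(blockKey I.l I.lf X b 1).val] ++
      [(blockKey I.l I.lf X b 2).val] ++ [(blockKey I.l I.lf X b 3).val] ++
      [(blockKey I.l I.lf X b 4).val] ++ [(peer (blockOpened I.l I.lf X)
        (send I.lf (I.s b i) (I.g b i) (blockKey I.l I.lf X b))).1.val] ++
      [(peer (blockOpened I.l I.lf X)
        (send I.lf (I.s b i) (I.g b i) (blockKey I.l I.lf X b))).2.val] := by
    simp [Instance.entry, List.ofFn_succ]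
  rw [he]
  simp only [← List.append_assoc]
  exact leads_assign_weight (hs _ hd) (update_reg_four _ _ _ _ _ _ _ _)

theorem init_eq (input : List ℕ) : State.init input = state input [] 0 0 0 0 0 := by
  simp only [State.init, state, State.mk.injEq, and_true]
  funext x
  split <;> rfl

theorem leads_echo (M F : ℕ) (hM : Nat.size M ≤ bound I) (hF : Nat.size F ≤ bound I) :
    Leads echo (echo.weight * bound I ^ 2) (state (I.input b ++ [y.val]) [] 0 0 M F 0)
      (state (I.input b ++ [y.val]) (I.input b) 0 0 M F (3 + 2 * I.N)) := by
  have hN := N_le_bound I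
  have hs (out : List ℕ) {i : ℕ} (hi : i ≤ bound I) :
      (state (I.input b ++ [y.val]) out 0 0 M F i).SizeLE (bound I) :=
    sizeLE_state out (size_le_bound I b y) (by omega) (by omega) (by simp) hM hF hi
  -- Invariant: the first `i` entries have been copied. The 3 + 2N passes stop before the appended
  -- output share y.
  let σ : ℕ → State := fun i => state (I.input b ++ [y.val]) ((I.input b).take i) 0 0 M F i
  have hσ : σ (3 + 2 * I.N) =
      state (I.input b ++ [y.val]) (I.input b) 0 0 M F (3 + 2 * I.N) := by
    simp only [σ, ← length_input I b, List.take_length]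
  rw [← hσ]
  refine Leads.loop_weight (σ := σ) (hs _ (Nat.zero_le _)) rfl hN fun i hi => ?_
  have hi' : i < (I.input b).length := by rwa [length_input]
  refine .seq_weight (leads_emit_weight (hs _ (by omega)) rfl)
    (leads_assign_weight (hs _ (by omega)) ((update_reg_four _ _ _ _ _ _ _ _).trans ?_))
  have h : (Expr.inp (.reg 4)).eval (σ i) = (I.input b)[i] := by
    change (I.input b ++ [y.val]).getD i 0 = _
    simp [List.getElem?_append, hi']
  change state _ ((I.input b).take i ++ [(Expr.inp (.reg 4)).eval (σ i)]) _ _ _ _ (i + 1) = _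
  rw [h, List.take_append_getElem hi']
  rfl

theorem leads_blocks {c X : ℕ} (hc : c ≤ 1) (hX : Nat.size X ≤ bound I) :
    Leads (.loop (.inp (.lit 2)) (body b))
      ((Prog.loop (.inp (.lit 2)) (body b)).weight * bound I ^ 2)
      (state (I.input b ++ [y.val]) (I.input b) c X (2 ^ I.l) (2 ^ I.lf) 0)
      (state (I.input b ++ [y.val]) (I.viewOf b (blocks I.l I.lf I.N b X)) c
        ((dropBlock I.l I.lf)^[I.N] X) (2 ^ I.l) (2 ^ I.lf) I.N) := by
  have hl := l_add_two_le_bound I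
  have hN := N_le_bound I
  have hlf := I.lf_le
  let q := blocks I.l I.lf I.N b X
  -- Invariant: `i` entries of the view are written, and register 1 holds the number with `i` blocks
  -- removed.
  let σ : ℕ → State := fun i => state (I.input b ++ [y.val])
    (I.input b ++ ((List.finRange I.N).take i).flatMap fun i => I.entry b i (q.1 i) (q.2 i)) c
    ((dropBlock I.l I.lf)^[i] X) (2 ^ I.l) (2 ^ I.lf) i
  have h0 : σ 0 = state (I.input b ++ [y.val]) (I.input b) c X (2 ^ I.l) (2 ^ I.lf) 0 := by
    simp [σ]
  have hσ : σ I.N = state (I.input b ++ [y.val]) (I.viewOf b q) c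
      ((dropBlock I.l I.lf)^[I.N] X) (2 ^ I.l) (2 ^ I.lf) I.N := by
    simp only [σ, Instance.viewOf]
    rw [List.take_of_length_le (by simp)]
  rw [← h0, ← hσ]
  refine Leads.loop_weight ?_ rfl (by omega) fun i hi => ?_
  · rw [h0]
    exact sizeLE_state _ (size_le_bound I b y) (by omega) hc hX
      (Nat.size_pow.trans_le (by omega)) (Nat.size_pow.trans_le (by omega)) (Nat.zero_le _)
  · have hXi : ∀ i, Nat.size ((dropBlock I.l I.lf)^[i] X) ≤ bound I := fun i => by
      induction i with
      | zero => exact hX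
      | succ i ih =>
        rw [Function.iterate_succ_apply', dropBlock_eq]
        exact (Nat.size_le_size (Nat.div_le_self _ _)).trans ih
    have h := leads_body I b y (I.input b ++ ((List.finRange I.N).take i).flatMap
      fun i => I.entry b i (q.1 i) (q.2 i)) hc (hXi i) ⟨i, hi⟩
    have hi' : i < (List.finRange I.N).length := by simpa using hi
    have ht : σ (i + 1) = state (I.input b ++ [y.val])
        (I.input b ++ ((List.finRange I.N).take i).flatMap
          (fun i => I.entry b i (q.1 i) (q.2 i)) ++ I.entry b ⟨i, hi⟩ (q.1 ⟨i, hi⟩) (q.2 ⟨i, hi⟩))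
        c (dropBlock I.l I.lf ((dropBlock I.l I.lf)^[i] X)) (2 ^ I.l) (2 ^ I.lf) (i + 1) := by
      simp only [σ, Function.iterate_succ_apply', ← List.take_append_getElem hi',
        List.flatMap_append, List.append_assoc]
      simp
    rw [ht]
    exact h

theorem samples_simulator :
    Samples (simulator b) ((simulator b).weight * bound I ^ 2)
      (State.init (I.input b ++ [y.val])) (Fin (2 ^ drawBits I.l I.lf I.N))
      fun r => state (I.input b ++ [y.val])
        (I.viewOf b (blocks I.l I.lf I.N b (seed I.l y.val r))) (r % 2)
        ((dropBlock I.l I.lf)^[I.N] (seed I.l y.val r)) (2 ^ I.l) (2 ^ I.lf) I.N := by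
  have hl := l_add_two_le_bound I
  have hN := N_le_bound I
  have hlf := I.lf_le
  have hd := drawBits_lt_bound I
  have hs (out : List ℕ) {c X M F i : ℕ} (hc : c ≤ 1) (hX : Nat.size X ≤ bound I)
      (hM : Nat.size M ≤ bound I) (hF : Nat.size F ≤ bound I) (hi : i ≤ bound I) :
      (state (I.input b ++ [y.val]) out c X M F i).SizeLE (bound I) :=
    sizeLE_state out (size_le_bound I b y) (by omega) hc hX hM hF hi
  have hM : Nat.size (2 ^ I.l) ≤ bound I := Nat.size_pow.trans_le (by omega)
  have hF : Nat.size (2 ^ I.lf) ≤ bound I := Nat.size_pow.trans_le (by omega)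
  have h0 : Nat.size 0 ≤ bound I := by simp
  rw [init_eq, simulator]
  have hpow₂ := leads_pow (x := 2) (e := .inp (.lit 0)) (k := I.l)
    (hs [] (c := 0) (X := 0) (M := 0) (F := 0) (i := 0) (by omega) h0 h0 h0 (by omega))
    (by omega) rfl
  have hpow₃ := leads_pow (x := 3) (e := .inp (.lit 1)) (k := I.lf)
    (hs [] (c := 0) (X := 0) (M := 2 ^ I.l) (F := 0) (i := 0) (by omega) h0 hM h0 (by omega))
    (by omega) rfl
  rw [update_reg_two] at hpow₂
  rw [update_reg_three] at hpow₃
  refine Leads.seq_samples_weight hpow₂ (Leads.seq_samples_weight hpow₃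
    (Leads.seq_samples_weight (leads_echo I b y _ _ hM hF) ?_))
  refine Leads.seq_samples_weight ((leads_assign_weight (hs _ (by omega) h0 hM hF hN)
    (update_reg_four _ _ _ _ _ _ _ _)).square) ?_
  have hdraw := samples_draw_weight (x := 1) (y := 0) (e := drawExpr) one_ne_zero rfl rfl
    (hs (I.input b) (c := 0) (X := 0) (M := 2 ^ I.l) (F := 2 ^ I.lf) (i := 0) (by omega) h0 hM hF
      (by omega)) (k := drawBits I.l I.lf I.N) rfl hd
  simp only [set₂_state] at hdraw
  refine .seq_leads_weight hdraw fun r => ?_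
  have hr : (r % 2 : ℕ) ≤ 1 := by omega
  refine .seq_weight ((leads_assign_weight
    (hs _ hr ((Nat.size_le.2 r.2).trans hd.le) hM hF (by omega))
    ((update_reg_one _ _ _ _ _ _ _ _).trans ?_)).square) (leads_blocks I b y hr
      ((Nat.size_le.2 (seed_lt I.N_pos y r)).trans (blockBits_lt_bound I).le))
  exact congrArg (fun a => state (I.input b ++ [y.val]) (I.input b) (r % 2) (r * 2 ^ I.l + a)
    (2 ^ I.l) (2 ^ I.lf) 0) (getD_input_last I b y)

end

end Simulator

end Agg

theorem mainTheorem2 :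
    PrivatelyComputes Agg.Instance.size (fun b I => Agg.Instance.input I b)
      (fun _ y => [y.val]) Agg.Instance.ideal Agg.Instance.exec ∧
    ∀ (I : Agg.Instance) (b : Fin 2),
      (I.coins.map fun c => ((fun i => Agg.key (c i) b), I.opened c)) =
        PMF.uniformOfFintype ((Fin I.N → Agg.Key I.l) × (Fin I.N → Agg.Masked I.lf)) := by
  refine ⟨⟨fun b => Agg.Simulator.simulator b, fun b => ⟨?_, fun I => ?_⟩⟩,
    fun I b => I.map_coins b⟩
  · refine ⟨.C (Agg.Simulator.simulator b).weight * (.C 4 * .X + .C 10) ^ 2, fun I y => ?_⟩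
    have h := (Agg.Simulator.samples_simulator I b y).stopsWithin
    simpa only [Polynomial.eval_mul, Polynomial.eval_pow, Polynomial.eval_add, Polynomial.eval_C,
      Polynomial.eval_X, Agg.Simulator.bound] using h
  · exact I.simulation b (fun y => (Agg.Simulator.simulator b).output (I.input b ++ [y.val]))
      fun y => (Agg.Simulator.samples_simulator I b y).output_eq
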